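/- The QISM I algebra is the unital associative complex algebra generated by the entries $A(u),B(u),C(u),D(u)$ of $T(u)=\begin{pmatrix}A(u)&B(u)\\C(u)&D(u)\end{pmatrix}$ ($u\in\mathbb C$) subject to $R(u-v)\,T^{(1)}(u)\,T^{(2)}(v)=T^{(2)}(v)\,T^{(1)}(u)\,R(u-v)$ for all $u,v\in\mathbb C$, where $T^{(1)}(u)=T(u)\otimes I$, $T^{(2)}(v)=I\otimes T(v)$, $R(u)=u+P$ and $P$ is the flip of $\mathbb C^2\otimes\mathbb C^2$. Its quantum determinant is $\Delta(u)=A(u-\tfrac12)D(u+\tfrac12)-C(u-\tfrac12)B(u+\tfrac12)$. Let the algebra act on a complex vector space $W$, and let $\mathcal D=\{u_0+m\mid m\in\mathbb Z,\ j_-<m<j_+\}$ with $u_0\in\mathbb C$, $j_-\in\mathbb Z\cup\{-\infty\}$, $j_+\in\mathbb Z\cup\{+\infty\}$. We say that the *string conditions* hold on $\mathcal D$ if (i) $\{w\in W\mid C(u)w=0\}$ is one-dimensional for each $u\in\mathcal D$, and (ii) whenever $u\in\mathcal D$, $0\ne w\in W$ and $C(u)w=0$, then $A(u)w=0$ if and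 only if $u=u_0+j_-+1$, and $D(u)w=0$ if and only if $u=u_0+j_+-1$ (never, if the respective end is infinite). Write $\partial=d/dx$. **Type B.** Let $a,c\in\mathbb C$ with $c\neq 0,-1,-2,\dots$, and let $W$ be the space of entire functions on $\mathbb C$. Then $$A(u)=x\partial-x+c-a-u,\quad B(u)=-x,\quad C(u)=-\bigl(x\partial^2+(c-x)\partial-a-u\bigr),\quad D(u)=x\partial+a+u$$ define a representation of the QISM I algebra on $W$, $B(u)$ is injective, and $\Delta(u)$ acts as the scalar $-u^2+(c-2a)u+a(c-a)-\tfrac12c+\tfrac14$. For every $u\in\mathbb C$ the function $F(u)(x)={}_1F_1(a+u;c;x)$ is a non-zero element of $W$ with $C(u)F(u)=0$, $A(u)F(u)=(c-a-u)F(u-1)$ and $D(u)F(u)=(a+u)F(u+1)$. The string conditions hold on $\mathcal D=u_0+\mathbb Z$ whenever $u_0\notin(-a+\mathbb Z)\cup(c-a+\mathbb Z)$, and on $\mathcal D=\{-a,-a-1,-a-2,\dots\}$ (with $u_0=-a$, $j_-=-\infty$, $j_+=1$). In the latter case $F(u)$ is a multiple of a Laguerre polynomial: $L_n^{c-1}(x)=\frac{(c)_n}{n!}F(-a-n)(x)$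 for $n=0,1,2,\dots$ **Type D'.** Let $W$ be the space of entire functions $f$ on $\mathbb C$ such that $f$ and all its derivatives are on $(0,\infty)$ of at most polynomial growth as $x\to\infty$. Then $$A(u)=\partial-x,\quad B(u)=-1,\quad C(u)=-(\partial^2-x\partial-u),\quad D(u)=\partial$$ define a representation of the QISM I algebra on $W$, $B(u)$ is injective, and $\Delta(u)$ acts as the scalar $u-\tfrac12$. For every $u\in\mathbb C$ the function $F(u)(x)=e^{x^2/4}D_{-u}(x)$, where $D_\nu$ is the parabolic cylinder function, is a non-zero element of $W$ with $C(u)F(u)=0$, $A(u)F(u)=-F(u-1)$, $D(u)F(u)=-uF(u+1)$, and $F(u)(x)=x^{-u}+O(x^{-u-2})$ as $x\to+\infty$. The string conditions hold on $\mathcal D=u_0+\mathbb Z$ whenever $u_0\notin\mathbb Z$, and on $\mathcal D=\{0,-1,-2,\dots\}$ (with $u_0=0$, $j_-=-\infty$, $j_+=1$). In the latter case $F(u)$ is a Hermite polynomial: $F(-n)(x)=He_n(x)=2^{-n/2}H_n(2^{-1/2}x)$ for $n=0,1,2,\dots$ -/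

import Mathlib

open Filter Asymptotics
open scoped Kronecker Nat

noncomputable section

/-! ### The QISM I algebra -/

namespace QISMI

/-- The rational R-matrix `R(u) = u + P` (with `κ = 1`), where `P` is the flip of `ℂ² ⊗ ℂ²`. -/
def R (u : ℂ) : Matrix (Fin 2 × Fin 2) (Fin 2 × Fin 2) ℂ :=
  u • (1 : Matrix (Fin 2 × Fin 2) (Fin 2 × Fin 2) ℂ) +
    Matrix.of fun p q => if p.1 = q.2 ∧ p.2 = q.1 then 1 else 0

/-- The free algebra on the symbols `T(u)_{ij}`, for `i, j ∈ {0, 1}` and `u ∈ ℂ`. -/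
abbrev Free : Type := FreeAlgebra ℂ (Fin 2 × Fin 2 × ℂ)

/-- The 2×2 matrix `T(u)` of free generators. -/
def freeT (u : ℂ) : Matrix (Fin 2) (Fin 2) Free :=
  Matrix.of fun i j => FreeAlgebra.ι ℂ (i, j, u)

/-- The 4×4 matrix `R(u)` with its scalar entries regarded in the free algebra. -/
def freeR (u : ℂ) : Matrix (Fin 2 × Fin 2) (Fin 2 × Fin 2) Free :=
  (R u).map (algebraMap ℂ Free)

/-- `T⁽¹⁾(u) = T(u) ⊗ I`. -/
def freeT₁ (u : ℂ) : Matrix (Fin 2 × Fin 2) (Fin 2 × Fin 2) Free :=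
  freeT u ⊗ₖ (1 : Matrix (Fin 2) (Fin 2) Free)

/-- `T⁽²⁾(v) = I ⊗ T(v)`. -/
def freeT₂ (v : ℂ) : Matrix (Fin 2 × Fin 2) (Fin 2 × Fin 2) Free :=
  (1 : Matrix (Fin 2) (Fin 2) Free) ⊗ₖ freeT v

/-- The entries of `R(u-v) T⁽¹⁾(u) T⁽²⁾(v) = T⁽²⁾(v) T⁽¹⁾(u) R(u-v)`. -/
inductive Rel : Free → Free → Prop
  | rtt (u v : ℂ) (p q : Fin 2 × Fin 2) :
      Rel ((freeR (u - v) * freeT₁ u * freeT₂ v) p q)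
        ((freeT₂ v * freeT₁ u * freeR (u - v)) p q)

end QISMI

/-- The QISM I algebra. -/
abbrev QISMI : Type := RingQuot QISMI.Rel

namespace QISMI

/-- The matrix `T(u)`, whose entries are the generators `A(u)`, `B(u)`, `C(u)`, `D(u)`. -/
def T (u : ℂ) : Matrix (Fin 2) (Fin 2) QISMI :=
  (freeT u).map (RingQuot.mkAlgHom ℂ Rel)

def A (u : ℂ) : QISMI := T u 0 0
def B (u : ℂ) : QISMI := T u 0 1
def C (u : ℂ) : QISMI := T u 1 0
def D (u : ℂ) : QISMI := T u 1 1

/-- The quantum determinant. -/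
def qdet (u : ℂ) : QISMI :=
  A (u - 1 / 2) * D (u + 1 / 2) - C (u - 1 / 2) * B (u + 1 / 2)

/-- For the string `𝒟 = {u₀ + m | m ∈ ℤ, j₋ < m < j₊}`, with `j₋ ∈ {-∞} ∪ ℤ` and `j₊ ∈ ℤ ∪ {+∞}`:
the null space of `C(u)` is one-dimensional for `u ∈ 𝒟`, and on a non-zero null vector of `C(u)`
the operator `A(u)` vanishes exactly at the lower end `u = u₀ + j₋ + 1` of `𝒟` and `D(u)` vanishes
exactly at the upper end `u = u₀ + j₊ - 1` of `𝒟` (never, if the end is infinite). -/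
structure StringConditions {W : Type*} [AddCommGroup W] [Module ℂ W]
    (ρ : QISMI →ₐ[ℂ] Module.End ℂ W) (u₀ : ℂ) (jm : WithBot ℤ) (jp : WithTop ℤ) : Prop where
  finrank_ker : ∀ m : ℤ, jm < m → (m : WithTop ℤ) < jp →
    Module.finrank ℂ (LinearMap.ker (ρ (C (u₀ + m)))) = 1
  lower : ∀ m : ℤ, jm < m → (m : WithTop ℤ) < jp →
    ∀ w : W, w ≠ 0 → ρ (C (u₀ + m)) w = 0 →
      (ρ (A (u₀ + m)) w = 0 ↔ jm + 1 = (m : WithBot ℤ))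
  upper : ∀ m : ℤ, jm < m → (m : WithTop ℤ) < jp →
    ∀ w : W, w ≠ 0 → ρ (C (u₀ + m)) w = 0 →
      (ρ (D (u₀ + m)) w = 0 ↔ (m : WithTop ℤ) + 1 = jp)

end QISMI

/-! ### Function spaces and the operators `∂` and `x` on them -/

/-- The entire functions on `ℂ`. -/
def entireFun : Submodule ℂ (ℂ → ℂ) where
  carrier := {f | Differentiable ℂ f}
  add_mem' hf hg := Differentiable.add hf hg
  zero_mem' := differentiable_const 0
  smul_mem' c _ hf := Differentiable.const_smul hf c

theorem contDiff_of_mem_entireFun {f : ℂ → ℂ} (hf : f ∈ entireFun) (n : WithTop ℕ∞) :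
    ContDiff ℂ n f :=
  Differentiable.contDiff hf

/-- The entire functions that have on `(0, ∞)`, together with all their derivatives, at most
polynomial growth as `x → ∞`. -/
def polyGrowthFun : Submodule ℂ (ℂ → ℂ) where
  carrier := {f | Differentiable ℂ f ∧ ∀ p : ℕ, ∃ N : ℕ,
    (fun x : ℝ => iteratedDeriv p f (x : ℂ)) =O[atTop] (fun x : ℝ => x ^ N)}
  add_mem' := by
    rintro f g ⟨hf, hf'⟩ ⟨hg, hg'⟩
    refine ⟨hf.add hg, fun p => ?_⟩
    obtain ⟨M, hM⟩ := hf' p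
    obtain ⟨N, hN⟩ := hg' p
    refine ⟨max M N, ?_⟩
    have h : (fun x : ℝ => iteratedDeriv p (f + g) (x : ℂ)) =
        fun x : ℝ => iteratedDeriv p f (x : ℂ) + iteratedDeriv p g (x : ℂ) := by
      funext x
      exact iteratedDeriv_add (contDiff_of_mem_entireFun hf _).contDiffAt
        (contDiff_of_mem_entireFun hg _).contDiffAt
    rw [h]
    have key : ∀ K L : ℕ, K ≤ L → (fun x : ℝ => x ^ K) =O[atTop] fun x : ℝ => x ^ L := by
      intro K L hKL
      refine IsBigO.of_bound 1 ?_
      filter_upwards [eventually_ge_atTop (1 : ℝ)] with x hx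
      have hx0 : 0 ≤ x := zero_le_one.trans hx
      rw [one_mul, Real.norm_of_nonneg (pow_nonneg hx0 _), Real.norm_of_nonneg (pow_nonneg hx0 _)]
      exact pow_le_pow_right₀ hx hKL
    exact (hM.trans (key _ _ (le_max_left _ _))).add (hN.trans (key _ _ (le_max_right _ _)))
  zero_mem' := by
    refine ⟨differentiable_const 0, fun p => ⟨0, ?_⟩⟩
    have h : (fun x : ℝ => iteratedDeriv p (0 : ℂ → ℂ) (x : ℂ)) = fun _ => 0 := by
      funext x
      simp
    rw [h]
    exact isBigO_zero _ _
  smul_mem' := by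
    rintro c f ⟨hf, hf'⟩
    refine ⟨hf.const_smul c, fun p => ?_⟩
    obtain ⟨M, hM⟩ := hf' p
    refine ⟨M, ?_⟩
    have h : (fun x : ℝ => iteratedDeriv p (c • f) (x : ℂ)) =
        fun x : ℝ => c • iteratedDeriv p f (x : ℂ) := by
      funext x
      exact iteratedDeriv_const_smul (contDiff_of_mem_entireFun hf _).contDiffAt c
    rw [h]
    exact hM.const_smul_left c

/-- A space of entire functions on which `∂ = d/dx` and multiplication by `x` act. -/
class StableSpace (W : Submodule ℂ (ℂ → ℂ)) : Prop where
  differentiable : ∀ f ∈ W, Differentiable ℂ f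
  deriv_mem : ∀ f ∈ W, deriv f ∈ W
  mul_mem : ∀ f ∈ W, (fun x : ℂ => x * f x) ∈ W

/-- The operator `∂ = d/dx` on `W`. -/
def opD (W : Submodule ℂ (ℂ → ℂ)) [StableSpace W] : Module.End ℂ W where
  toFun f := ⟨deriv (f : ℂ → ℂ), StableSpace.deriv_mem _ f.2⟩
  map_add' f g := by
    ext x
    exact deriv_add (StableSpace.differentiable _ f.2 x) (StableSpace.differentiable _ g.2 x)
  map_smul' c f := by
    ext x
    exact deriv_const_smul c (StableSpace.differentiable _ f.2 x)

/-- The operator of multiplication by `x` on `W`. -/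
def opX (W : Submodule ℂ (ℂ → ℂ)) [StableSpace W] : Module.End ℂ W where
  toFun f := ⟨fun x => x * (f : ℂ → ℂ) x, StableSpace.mul_mem _ f.2⟩
  map_add' f g := by
    ext x
    exact mul_add x _ _
  map_smul' c f := by
    ext x
    exact mul_left_comm x c _

theorem differentiable_deriv_of_entire {f : ℂ → ℂ} (hf : Differentiable ℂ f) :
    Differentiable ℂ (deriv f) := by
  have h : ContDiff ℂ 2 f := hf.contDiff
  exact (contDiff_succ_iff_deriv (n := 1)).1 (by exact_mod_cast h) |>.2.2.differentiable
    one_ne_zero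

instance : StableSpace entireFun where
  differentiable _ hf := hf
  deriv_mem _ hf := differentiable_deriv_of_entire hf
  mul_mem _ hf := differentiable_id.mul hf

theorem iteratedDeriv_id_mul_entire {f : ℂ → ℂ} (hf : Differentiable ℂ f) (p : ℕ) :
    iteratedDeriv p (fun x : ℂ => x * f x) =
      fun x => x * iteratedDeriv p f x + p * iteratedDeriv (p - 1) f x := by
  have hd : ∀ k : ℕ, Differentiable ℂ (iteratedDeriv k f) := fun k =>
    hf.contDiff.differentiable_iteratedDeriv k (WithTop.coe_lt_coe.2 (ENat.natCast_lt_top k))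
  induction p with
  | zero => funext x; simp
  | succ p ih =>
    rw [iteratedDeriv_succ, ih]
    funext x
    have h1 : HasDerivAt (fun x : ℂ => x * iteratedDeriv p f x + p * iteratedDeriv (p - 1) f x)
        ((1 * iteratedDeriv p f x + x * iteratedDeriv (p + 1) f x) +
          p * iteratedDeriv ((p - 1) + 1) f x) x := by
      refine ((hasDerivAt_id x).mul ?_).add (HasDerivAt.const_mul _ ?_)
      · rw [iteratedDeriv_succ]; exact (hd p x).hasDerivAt
      · rw [iteratedDeriv_succ]; exact (hd (p - 1) x).hasDerivAt
    rw [h1.deriv]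
    rcases p with _ | p
    · simp; ring
    · simp only [Nat.add_sub_cancel]; push_cast; ring

instance : StableSpace polyGrowthFun where
  differentiable _ hf := hf.1
  deriv_mem f hf := by
    refine ⟨differentiable_deriv_of_entire hf.1, fun p => ?_⟩
    rw [← iteratedDeriv_succ']
    exact hf.2 (p + 1)
  mul_mem f hf := by
    refine ⟨differentiable_id.mul hf.1, fun p => ?_⟩
    obtain ⟨M, hM⟩ := hf.2 p
    obtain ⟨N, hN⟩ := hf.2 (p - 1)
    refine ⟨(M + 1) + N, ?_⟩
    rw [iteratedDeriv_id_mul_entire hf.1]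
    have key : ∀ K L : ℕ, K ≤ L → (fun x : ℝ => x ^ K) =O[atTop] fun x : ℝ => x ^ L := by
      intro K L hKL
      refine IsBigO.of_bound 1 ?_
      filter_upwards [eventually_ge_atTop (1 : ℝ)] with x hx
      have hx0 : 0 ≤ x := zero_le_one.trans hx
      rw [one_mul, Real.norm_of_nonneg (pow_nonneg hx0 _), Real.norm_of_nonneg (pow_nonneg hx0 _)]
      exact pow_le_pow_right₀ hx hKL
    have hx : (fun x : ℝ => (x : ℂ)) =O[atTop] fun x : ℝ => x :=
      IsBigO.of_bound 1 (Eventually.of_forall fun x => by simp)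
    refine IsBigO.add ?_ ?_
    · refine ((hx.mul hM).congr_right fun x => ?_).trans (key (M + 1) _ (by omega))
      ring
    · exact (hN.const_mul_left _).trans (key N _ (by omega))

/-! ### The L-operators -/

/-- Type B:
`A(u) = x∂ - x + c - a - u`, `B(u) = -x`, `C(u) = -(x∂² + (c - x)∂ - a - u)`,
`D(u) = x∂ + a + u`, on the entire functions. -/
def typeB (a c u : ℂ) : Matrix (Fin 2) (Fin 2) (Module.End ℂ entireFun) :=
  let d := opD entireFun
  let x := opX entireFun
  !![x * d - x + (c - a - u) • 1, -x;
     -(x * d ^ 2 + (c • 1 - x) * d - (a + u) • 1), x * d + (a + u) • 1]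

/-- Type D':
`A(u) = ∂ - x`, `B(u) = -1`, `C(u) = -(∂² - x∂ - u)`, `D(u) = ∂`,
on the entire functions of polynomial growth. -/
def typeD' (u : ℂ) : Matrix (Fin 2) (Fin 2) (Module.End ℂ polyGrowthFun) :=
  let d := opD polyGrowthFun
  let x := opX polyGrowthFun
  !![d - x, -1; -(d ^ 2 - x * d - u • 1), d]

/-! ### Special functions -/

/-- The confluent hypergeometric function `₁F₁(a; c; x) = ∑ (a)_k / ((c)_k k!) x^k`
(for `c ≠ 0, -1, -2, …`). -/
def oneFOne (a c x : ℂ) : ℂ :=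
  ∑' k : ℕ, (ascPochhammer ℂ k).eval a / ((ascPochhammer ℂ k).eval c * (k ! : ℂ)) * x ^ k

/-- The parabolic cylinder function `D_ν(x)`, entire in `ν` and `x`. This is
`2^{(ν-1)/2} e^{-x²/4} x Ψ((1-ν)/2, 3/2; x²/2)` with Tricomi's `Ψ(α, γ; y)` written out as
`Γ(1-γ)/Γ(α-γ+1) ₁F₁(α; γ; y) + Γ(γ-1)/Γ(α) y^{1-γ} ₁F₁(α-γ+1; 2-γ; y)`; `1/Γ` is `0` at the
poles of `Γ`. -/
def parabolicCylinderD (ν x : ℂ) : ℂ :=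
  (2 : ℂ) ^ (ν / 2) * Complex.exp (-x ^ 2 / 4) * (Real.sqrt Real.pi : ℂ) *
    (oneFOne (-ν / 2) (1 / 2) (x ^ 2 / 2) / Complex.Gamma ((1 - ν) / 2) -
      (Real.sqrt 2 : ℂ) * x * oneFOne ((1 - ν) / 2) (3 / 2) (x ^ 2 / 2) /
        Complex.Gamma (-ν / 2))

/-- The Laguerre polynomial `L_n^α(x) = ∑_{k ≤ n} (-1)^k binom(n+α, n-k) x^k / k!`, where
`binom(n+α, n-k) = (α+k+1)_{n-k} / (n-k)!`. -/
def laguerre (n : ℕ) (α x : ℂ) : ℂ :=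
  ∑ k ∈ Finset.range (n + 1),
    (-1) ^ k * ((ascPochhammer ℂ (n - k)).eval (α + k + 1) / ((n - k)! : ℂ)) * x ^ k / (k ! : ℂ)

end

/-! ### Representations of the QISM I algebra -/

/-! With ∂x = x∂ + 1, every component of the RTT relation and the quantum determinant formula are
identities in the first Weyl algebra, so both families of operators define representations
(`entryRTT_kummer`, `entryRTT_hermite`, `exists_algHom`). What remains concerns two differential
equations: C(u)w = 0 is Kummer's equation for type B and Hermite's equation for type D'. The string
conditions follow formally (`StringConditions.of_ladder`) once the null space of C(u) is the line
through F(u) and A, D shift F by scalar factors: those factors vanish exactly at the ends of the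
string.

Type B: at the regular singular point 0, Kummer's equation becomes a two-term recurrence for Taylor
coefficients. Since c is not a non-positive integer, an entire solution is determined by its value
at 0 (`eq_smul_oneFOne`). A and D carry solutions to solutions with parameter shifted by one, so the
ladder factors are read off at x = 0.

Type D': 0 is an ordinary point, so a solution is determined by its value and derivative there
(`eq_smul_of_hermiteOp_eq_zero`), and the ladder relations reduce to Gamma function identities. Both
dimensions of the solution space are entire, and the growth condition must cut out a line. By
`weberAsymptotic`, e^{x²/4}D_{-u}(x) lies in the space; by `eq_smul_weber`, any other solution of
polynomial growth has zero Wronskian with it. The asymptotics come from an integral representation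
for Re u > 0 (`weberIntegral_eq`) and are carried to all u by the three-term recurrence. -/

namespace QISMI

section Lift

variable {E : Type*} [Ring E] [Algebra ℂ E]

/-- The RTT relation written out in matrix entries. -/
def EntryRTT (t : ℂ → Matrix (Fin 2) (Fin 2) E) : Prop :=
  ∀ (u v : ℂ) (i j k l : Fin 2),
    (u - v) • (t u i j * t v k l) + t u k j * t v i l =
      (u - v) • (t v k l * t u i j) + t v k j * t u i l

theorem freeR_apply (w : ℂ) (p q : Fin 2 × Fin 2) :
    freeR w p q = (if p = q then algebraMap ℂ Free w else 0) + if p.swap = q then 1 else 0 := by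
  have h : (p.1 = q.2 ∧ p.2 = q.1) ↔ p.swap = q := by
    rw [Prod.ext_iff, and_comm]; rfl
  simp only [freeR, R, Matrix.map_apply, Matrix.add_apply, Matrix.smul_apply, Matrix.one_apply,
    Matrix.of_apply, map_add, smul_eq_mul, h]
  split_ifs <;> simp

theorem freeR_mul (w : ℂ) (M : Matrix (Fin 2 × Fin 2) (Fin 2 × Fin 2) Free)
    (p q : Fin 2 × Fin 2) : (freeR w * M) p q = w • M p q + M p.swap q := by
  simp only [Matrix.mul_apply, freeR_apply, add_mul, ite_mul, zero_mul, one_mul,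
    Finset.sum_add_distrib, Finset.sum_ite_eq, Finset.mem_univ, if_true, Algebra.smul_def]

theorem mul_freeR (w : ℂ) (M : Matrix (Fin 2 × Fin 2) (Fin 2 × Fin 2) Free)
    (p q : Fin 2 × Fin 2) : (M * freeR w) p q = w • M p q + M p q.swap := by
  have h : ∀ r : Fin 2 × Fin 2, r.swap = q ↔ r = q.swap := fun r =>
    ⟨fun h => by rw [← h, Prod.swap_swap], fun h => by rw [h, Prod.swap_swap]⟩
  simp only [Matrix.mul_apply, freeR_apply, mul_add, mul_ite, mul_zero, mul_one, h,
    Finset.sum_add_distrib, Finset.sum_ite_eq', Finset.mem_univ, if_true, Algebra.smul_def,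
    Algebra.commutes]

theorem freeT₁_mul_freeT₂ (u v : ℂ) (p q : Fin 2 × Fin 2) :
    (freeT₁ u * freeT₂ v) p q = freeT u p.1 q.1 * freeT v p.2 q.2 := by
  simp [Matrix.mul_apply, freeT₁, freeT₂, Fintype.sum_prod_type, Matrix.one_apply]

theorem freeT₂_mul_freeT₁ (u v : ℂ) (p q : Fin 2 × Fin 2) :
    (freeT₂ v * freeT₁ u) p q = freeT v p.2 q.2 * freeT u p.1 q.1 := by
  simp [Matrix.mul_apply, freeT₁, freeT₂, Fintype.sum_prod_type, Matrix.one_apply]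

/-- A matrix-valued function with the RTT relation defines a representation. -/
theorem exists_algHom {t : ℂ → Matrix (Fin 2) (Fin 2) E} (ht : EntryRTT t) :
    ∃ ρ : QISMI →ₐ[ℂ] E, ∀ u, (T u).map ρ = t u := by
  have hT : ∀ u i j, FreeAlgebra.lift ℂ (fun g : Fin 2 × Fin 2 × ℂ => t g.2.2 g.1 g.2.1)
      (freeT u i j) = t u i j := fun u i j => by simp [freeT]
  refine ⟨RingQuot.liftAlgHom ℂ
    ⟨FreeAlgebra.lift ℂ fun g : Fin 2 × Fin 2 × ℂ => t g.2.2 g.1 g.2.1, ?_⟩, fun u => ?_⟩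
  · rintro _ _ ⟨u, v, p, q⟩
    -- The flip swaps the row index when it acts from the left and the column index when it acts
    -- from the right; this produces the unscaled terms of `EntryRTT`.
    rw [mul_assoc, freeR_mul, mul_freeR]
    simp only [freeT₁_mul_freeT₂, freeT₂_mul_freeT₁, Prod.fst_swap, Prod.snd_swap, map_add,
      map_smul, map_mul, hT]
    exact ht u v _ _ _ _
  · ext i j
    simp only [T, Matrix.map_apply, RingQuot.liftAlgHom_mkAlgHom_apply]
    exact hT u i j

end Lift

/-! ### Weyl algebra identities: RTT relations and quantum determinants -/

section Weyl

variable {E : Type*} [Ring E] {x d : E}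

/-- In right-associated products `d * x` need not occur as a subterm; this form completes the
rewriting system that moves every `d` to the right of every `x`. -/
theorem weyl_assoc (h : d * x = x * d + 1) (y : E) : d * (x * y) = x * (d * y) + y := by
  rw [← mul_assoc, h, add_mul, one_mul, mul_assoc]

variable [Algebra ℂ E]

/-- After normal ordering, each of the sixteen relations is an equality of linear combinations of
the same monomials, which is a comparison of polynomial coefficients in `u`, `v`, `a`, `c`. -/
theorem entryRTT_kummer (h : d * x = x * d + 1) (a c : ℂ) :
    EntryRTT fun u : ℂ => (!![x * d - x + (c - a - u) • 1, -x;
      -(x * d ^ 2 + (c • 1 - x) * d - (a + u) • 1), x * d + (a + u) • 1] :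
        Matrix (Fin 2) (Fin 2) E) := by
  have h' := weyl_assoc h
  intro u v i j k l
  fin_cases i <;> fin_cases j <;> fin_cases k <;> fin_cases l <;>
    simp [sq, mul_add, add_mul, mul_sub, sub_mul, mul_assoc, h, h'] <;> module

theorem entryRTT_hermite (h : d * x = x * d + 1) :
    EntryRTT fun u : ℂ => (!![d - x, -1; -(d ^ 2 - x * d - u • 1), d] :
      Matrix (Fin 2) (Fin 2) E) := by
  have h' := weyl_assoc h
  intro u v i j k l
  fin_cases i <;> fin_cases j <;> fin_cases k <;> fin_cases l <;>
    simp [sq, mul_add, mul_sub, sub_mul, mul_assoc, h, h'] <;> module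

theorem qdet_kummer (h : d * x = x * d + 1) (a c u : ℂ) :
    (x * d - x + (c - a - (u - 1 / 2)) • 1) * (x * d + (a + (u + 1 / 2)) • 1) -
      -(x * d ^ 2 + (c • 1 - x) * d - (a + (u - 1 / 2)) • 1) * -x =
    (-u ^ 2 + (c - 2 * a) * u + (a * (c - a) - c / 2 + 1 / 4)) • 1 := by
  have h' := weyl_assoc h
  simp only [sq, mul_add, add_mul, mul_sub, sub_mul, mul_assoc, h, h', neg_mul, mul_neg,
    smul_mul_assoc, mul_smul_comm, mul_one, one_mul]
  module

theorem qdet_hermite (u : ℂ) :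
    (d - x) * d - -(d ^ 2 - x * d - (u - 1 / 2) • 1) * -1 = (u - 1 / 2) • (1 : E) := by
  simp only [sq, sub_mul, mul_neg, mul_one, neg_neg]
  module

end Weyl

end QISMI

theorem opD_mul_opX (W : Submodule ℂ (ℂ → ℂ)) [StableSpace W] :
    opD W * opX W = opX W * opD W + 1 := by
  ext f x
  have hf := StableSpace.differentiable _ f.2 x
  have := ((hasDerivAt_id x).mul hf.hasDerivAt).deriv
  simp only [id, one_mul] at this
  change deriv (fun x : ℂ => x * (f : ℂ → ℂ) x) x = x * deriv (f : ℂ → ℂ) x + (f : ℂ → ℂ) x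
  rw [add_comm, ← this]
  rfl

/-! ### Entire functions and their Taylor coefficients at the origin -/

theorem Differentiable.iteratedDeriv_entire {f : ℂ → ℂ} (hf : Differentiable ℂ f) (k : ℕ) :
    Differentiable ℂ (iteratedDeriv k f) :=
  hf.contDiff.differentiable_iteratedDeriv k (WithTop.coe_lt_coe.2 (ENat.natCast_lt_top k))

theorem hasDerivAt_iteratedDeriv_entire {f : ℂ → ℂ} (hf : Differentiable ℂ f) (k : ℕ) (x : ℂ) :
    HasDerivAt (iteratedDeriv k f) (iteratedDeriv (k + 1) f x) x := by
  rw [iteratedDeriv_succ]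
  exact (hf.iteratedDeriv_entire k x).hasDerivAt

/-- An entire function is the sum of its Taylor series at 0. All uniqueness statements for the two
differential equations rest on this. -/
theorem entire_eq_zero_of_iteratedDeriv_zero {f : ℂ → ℂ} (hf : Differentiable ℂ f)
    (h : ∀ k, iteratedDeriv k f 0 = 0) : f = 0 := by
  funext z
  rw [← Complex.taylorSeries_eq_of_entire' 0 z hf]
  simp [h]

/-! ### The Kummer equation -/

/-- The Kummer operator `x∂² + (c - x)∂ - a`. -/
noncomputable def kummerOp (a c : ℂ) (f : ℂ → ℂ) (x : ℂ) : ℂ :=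
  x * iteratedDeriv 2 f x + (c - x) * iteratedDeriv 1 f x - a * f x

theorem differentiable_kummerOp (a c : ℂ) {f : ℂ → ℂ} (hf : Differentiable ℂ f) :
    Differentiable ℂ (kummerOp a c f) :=
  ((differentiable_id.mul (hf.iteratedDeriv_entire 2)).add
    (((differentiable_const c).sub differentiable_id).mul (hf.iteratedDeriv_entire 1))).sub
    (hf.const_mul a)

/-- Each differentiation raises both parameters by one: the right-hand side is the Kummer operator
with parameters a + k, c + k applied to the k-th derivative. At x = 0 its second-order term drops
out. -/
theorem iteratedDeriv_kummerOp (a c : ℂ) {f : ℂ → ℂ} (hf : Differentiable ℂ f) (k : ℕ) :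
    iteratedDeriv k (kummerOp a c f) = fun x =>
      x * iteratedDeriv (k + 2) f x + (k + c - x) * iteratedDeriv (k + 1) f x -
        (k + a) * iteratedDeriv k f x := by
  induction k with
  | zero => funext x; simp [kummerOp]
  | succ k ih =>
    rw [iteratedDeriv_succ, ih]
    funext x
    have h := (((hasDerivAt_id x).mul (hasDerivAt_iteratedDeriv_entire hf (k + 2) x)).add
      (((hasDerivAt_id x).const_sub (k + c)).mul
        (hasDerivAt_iteratedDeriv_entire hf (k + 1) x))).sub
      ((hasDerivAt_iteratedDeriv_entire hf k x).const_mul (k + a))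
    refine h.deriv.trans ?_
    simp only [id]
    push_cast
    ring

/-- An entire function solves the Kummer equation iff its Taylor coefficients satisfy the
two-term recurrence. -/
theorem kummerOp_eq_zero_iff (a c : ℂ) {f : ℂ → ℂ} (hf : Differentiable ℂ f) :
    kummerOp a c f = 0 ↔
      ∀ k : ℕ, (k + c) * iteratedDeriv (k + 1) f 0 = (k + a) * iteratedDeriv k f 0 := by
  have key : ∀ k : ℕ, iteratedDeriv k (kummerOp a c f) 0 =
      (k + c) * iteratedDeriv (k + 1) f 0 - (k + a) * iteratedDeriv k f 0 := fun k => by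
    rw [iteratedDeriv_kummerOp a c hf]; simp
  constructor
  · intro h k
    have := key k
    rw [h] at this
    exact sub_eq_zero.1 (this.symm.trans (by simp))
  · intro h
    refine entire_eq_zero_of_iteratedDeriv_zero (differentiable_kummerOp a c hf) fun k => ?_
    rw [key, h, sub_self]

/-- The leading coefficient k + c of the recurrence never vanishes, so the value at 0 determines
every Taylor coefficient. -/
theorem eq_zero_of_kummerOp_eq_zero {a c : ℂ} (hc : ∀ n : ℕ, c ≠ -(n : ℂ)) {f : ℂ → ℂ}
    (hf : Differentiable ℂ f) (h : kummerOp a c f = 0) (h0 : f 0 = 0) : f = 0 := by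
  rw [kummerOp_eq_zero_iff a c hf] at h
  refine entire_eq_zero_of_iteratedDeriv_zero hf fun k => ?_
  induction k with
  | zero => simpa using h0
  | succ k ih =>
    have := h k
    rw [ih, mul_zero] at this
    refine (mul_eq_zero.1 this).resolve_left fun h' => hc k ?_
    linear_combination h'

/-! ### The function ₁F₁ as an entire solution of Kummer's equation -/

theorem kummer_Gamma_add {c : ℂ} (hc : ∀ n : ℕ, c ≠ -(n : ℂ)) (n : ℕ) :
    Complex.Gamma (c + n) = (ascPochhammer ℂ n).eval c * Complex.Gamma c := by
  induction n with
  | zero => simp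
  | succ n ih =>
    have h : c + n ≠ 0 := fun h => hc n (by linear_combination h)
    rw [Nat.cast_succ, ← add_assoc, Complex.Gamma_add_one _ h, ih, ascPochhammer_succ_right]
    simp
    ring

theorem ascPochhammer_eval_ne_zero {c : ℂ} (hc : ∀ n : ℕ, c ≠ -(n : ℂ)) (n : ℕ) :
    (ascPochhammer ℂ n).eval c ≠ 0 := by
  intro h
  have := kummer_Gamma_add hc n
  rw [h, zero_mul, Complex.Gamma_eq_zero_iff] at this
  obtain ⟨m, hm⟩ := this
  exact hc (n + m) (by push_cast; linear_combination hm)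

/-- The regularized series has Γ(c + k) = (c)_k Γ(c) in its denominators. The comparison supplies
the infinite radius of convergence. -/
theorem oneFOne_eq_regularizedHGFun {c : ℂ} (hc : ∀ n : ℕ, c ≠ -(n : ℂ)) (a : ℂ) :
    oneFOne a c = fun x => Complex.Gamma c * Complex.regularizedHGFun {a} {c} x := by
  have hG : Complex.Gamma c ≠ 0 := Complex.Gamma_ne_zero hc
  funext x
  rw [oneFOne, Complex.regularizedHGFun, FormalMultilinearSeries.sum, ← tsum_mul_left]
  refine tsum_congr fun k => ?_
  rw [FormalMultilinearSeries.apply_eq_pow_smul_coeff, Complex.regularizedHGFunSeries_coeff,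
    Complex.regularizedHGFunCoeff]
  simp only [Multiset.map_singleton, Multiset.prod_singleton, smul_eq_mul, kummer_Gamma_add hc]
  have := ascPochhammer_eval_ne_zero hc k
  field_simp

theorem hasFPowerSeriesOnBall_oneFOne {c : ℂ} (hc : ∀ n : ℕ, c ≠ -(n : ℂ)) (a : ℂ) :
    HasFPowerSeriesOnBall (oneFOne a c)
      (Complex.Gamma c • Complex.regularizedHGFunSeries {a} {c}) 0 ⊤ := by
  rw [oneFOne_eq_regularizedHGFun hc]
  have h : (Complex.regularizedHGFunSeries {a} {c}).radius = ⊤ :=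
    Complex.radius_regularizedHGFunSeries_eq_top (by simp)
  have := (Complex.regularizedHGFunSeries {a} {c}).hasFPowerSeriesOnBall (by simp [h])
  rw [h] at this
  exact this.const_smul (c := Complex.Gamma c)

theorem differentiable_oneFOne {c : ℂ} (hc : ∀ n : ℕ, c ≠ -(n : ℂ)) (a : ℂ) :
    Differentiable ℂ (oneFOne a c) := by
  have := (hasFPowerSeriesOnBall_oneFOne hc a).differentiableOn
  rwa [Metric.eball_top, differentiableOn_univ] at this

theorem iteratedDeriv_oneFOne_zero {c : ℂ} (hc : ∀ n : ℕ, c ≠ -(n : ℂ)) (a : ℂ) (k : ℕ) :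
    iteratedDeriv k (oneFOne a c) 0 =
      (ascPochhammer ℂ k).eval a / (ascPochhammer ℂ k).eval c := by
  have h := (hasFPowerSeriesOnBall_oneFOne hc a).factorial_smul (1 : ℂ) k
  rw [iteratedDeriv_eq_iteratedFDeriv, ← h]
  have hG : Complex.Gamma c ≠ 0 := Complex.Gamma_ne_zero hc
  have := ascPochhammer_eval_ne_zero hc k
  have hk : (k ! : ℂ) ≠ 0 := by exact_mod_cast k.factorial_ne_zero
  rw [FormalMultilinearSeries.smul_apply, smul_apply,
    FormalMultilinearSeries.apply_eq_pow_smul_coeff, Complex.regularizedHGFunSeries_coeff,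
    Complex.regularizedHGFunCoeff]
  simp only [Multiset.map_singleton, Multiset.prod_singleton, smul_eq_mul, kummer_Gamma_add hc,
    nsmul_eq_mul, one_pow, one_mul]
  field_simp

theorem oneFOne_zero {c : ℂ} (hc : ∀ n : ℕ, c ≠ -(n : ℂ)) (a : ℂ) : oneFOne a c 0 = 1 := by
  simpa using iteratedDeriv_oneFOne_zero hc a 0

theorem kummerOp_oneFOne {c : ℂ} (hc : ∀ n : ℕ, c ≠ -(n : ℂ)) (a : ℂ) :
    kummerOp a c (oneFOne a c) = 0 := by
  rw [kummerOp_eq_zero_iff _ _ (differentiable_oneFOne hc a)]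
  intro k
  rw [iteratedDeriv_oneFOne_zero hc, iteratedDeriv_oneFOne_zero hc]
  have h := ascPochhammer_eval_ne_zero hc (k + 1)
  simp only [ascPochhammer_succ_right, Polynomial.eval_mul, Polynomial.eval_add,
    Polynomial.eval_X, Polynomial.eval_natCast] at h ⊢
  have h1 := left_ne_zero_of_mul h
  have h2 := right_ne_zero_of_mul h
  field_simp
  ring

/-- An entire solution of the Kummer equation is a multiple of `₁F₁`. -/
theorem eq_smul_oneFOne {a c : ℂ} (hc : ∀ n : ℕ, c ≠ -(n : ℂ)) {f : ℂ → ℂ}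
    (hf : Differentiable ℂ f) (h : kummerOp a c f = 0) : f = f 0 • oneFOne a c := by
  have hM := differentiable_oneFOne hc a
  refine sub_eq_zero.1 (eq_zero_of_kummerOp_eq_zero (a := a) hc (hf.sub (hM.const_smul _)) ?_ ?_)
  · rw [kummerOp_eq_zero_iff _ _ (hf.sub (hM.const_smul _))]
    rw [kummerOp_eq_zero_iff _ _ hf] at h
    have h' := (kummerOp_eq_zero_iff _ _ hM).1 (kummerOp_oneFOne hc a)
    have e : ∀ k, iteratedDeriv k (f - f 0 • oneFOne a c) 0 =
        iteratedDeriv k f 0 - f 0 * iteratedDeriv k (oneFOne a c) 0 := fun k => by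
      rw [iteratedDeriv_sub hf.contDiff.contDiffAt (hM.const_smul _).contDiff.contDiffAt,
        iteratedDeriv_const_smul hM.contDiff.contDiffAt, smul_eq_mul]
    intro k
    rw [e, e]
    linear_combination h k - f 0 * h' k
  · simp [oneFOne_zero hc]

/-! ### The Hermite equation -/

/-- The Hermite operator `∂² - x∂ - u`. -/
noncomputable def hermiteOp (u : ℂ) (f : ℂ → ℂ) (x : ℂ) : ℂ :=
  iteratedDeriv 2 f x - x * iteratedDeriv 1 f x - u * f x

theorem hermiteOp_eq_of_hasDerivAt (u : ℂ) {f f₁ f₂ : ℂ → ℂ} (h₁ : ∀ x, HasDerivAt f (f₁ x) x)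
    (h₂ : ∀ x, HasDerivAt f₁ (f₂ x) x) (x : ℂ) :
    hermiteOp u f x = f₂ x - x * f₁ x - u * f x := by
  have e : deriv f = f₁ := funext fun y => (h₁ y).deriv
  rw [hermiteOp, iteratedDeriv_succ, iteratedDeriv_one, e, (h₂ x).deriv]

/-- Each differentiation raises the parameter by one. At x = 0 this leaves a recurrence linking the
Taylor coefficients of order k and k + 2. -/
theorem iteratedDeriv_hermiteOp (u : ℂ) {f : ℂ → ℂ} (hf : Differentiable ℂ f) (k : ℕ) :
    iteratedDeriv k (hermiteOp u f) = fun x =>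
      iteratedDeriv (k + 2) f x - x * iteratedDeriv (k + 1) f x -
        (k + u) * iteratedDeriv k f x := by
  induction k with
  | zero => funext x; simp [hermiteOp]
  | succ k ih =>
    rw [iteratedDeriv_succ, ih]
    funext x
    have h := ((hasDerivAt_iteratedDeriv_entire hf (k + 2) x).sub
      ((hasDerivAt_id x).mul (hasDerivAt_iteratedDeriv_entire hf (k + 1) x))).sub
      ((hasDerivAt_iteratedDeriv_entire hf k x).const_mul (k + u))
    refine h.deriv.trans ?_
    simp only [id]
    push_cast
    ring

theorem eq_zero_of_hermiteOp_eq_zero {u : ℂ} {f : ℂ → ℂ} (hf : Differentiable ℂ f)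
    (h : hermiteOp u f = 0) (h0 : f 0 = 0) (h1 : deriv f 0 = 0) : f = 0 := by
  have key : ∀ k : ℕ, iteratedDeriv k f 0 = 0 ∧ iteratedDeriv (k + 1) f 0 = 0 := by
    intro k
    induction k with
    | zero => exact ⟨by simpa using h0, by simpa using h1⟩
    | succ k ih =>
      refine ⟨ih.2, ?_⟩
      have := congrFun (iteratedDeriv_hermiteOp u hf k) 0
      rw [h, ih.1, ih.2] at this
      simpa using this.symm
  exact entire_eq_zero_of_iteratedDeriv_zero hf fun k => (key k).1

theorem hermiteOp_sub_smul {u : ℂ} {f g : ℂ → ℂ} (hf : Differentiable ℂ f)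
    (hg : Differentiable ℂ g) (r : ℂ) (hf0 : hermiteOp u f = 0) (hg0 : hermiteOp u g = 0) :
    hermiteOp u (f - r • g) = 0 := by
  have e : ∀ k x, iteratedDeriv k (f - r • g) x =
      iteratedDeriv k f x - r * iteratedDeriv k g x := fun k x => by
    rw [iteratedDeriv_sub hf.contDiff.contDiffAt (hg.const_smul _).contDiff.contDiffAt,
      iteratedDeriv_const_smul hg.contDiff.contDiffAt, smul_eq_mul]
  funext x
  have hf1 := congrFun hf0 x
  have hg1 := congrFun hg0 x
  simp only [hermiteOp, Pi.zero_apply] at hf1 hg1 ⊢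
  rw [e, e, Pi.sub_apply, Pi.smul_apply, smul_eq_mul]
  linear_combination hf1 - r * hg1

/-- Since 0 is an ordinary point, proportional initial data force proportional solutions. The ladder
relations, the integral representation and the description of the null space all come from this
comparison. -/
theorem eq_smul_of_hermiteOp_eq_zero {u : ℂ} {f g : ℂ → ℂ} (hf : Differentiable ℂ f)
    (hg : Differentiable ℂ g) (r : ℂ) (hf0 : hermiteOp u f = 0) (hg0 : hermiteOp u g = 0)
    (h0 : f 0 = r * g 0) (h1 : deriv f 0 = r * deriv g 0) : f = r • g := by
  refine sub_eq_zero.1 (eq_zero_of_hermiteOp_eq_zero (hf.sub (hg.const_smul r))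
    (hermiteOp_sub_smul hf hg r hf0 hg0) (by simp [h0]) ?_)
  rw [((hf 0).hasDerivAt.sub ((hg 0).hasDerivAt.const_smul r)).deriv, h1, smul_eq_mul, sub_self]

/-- The derivative maps solutions of parameter `u` to solutions of parameter `u + 1`. -/
theorem hermiteOp_deriv {u : ℂ} {f : ℂ → ℂ} (hf : Differentiable ℂ f) (h : hermiteOp u f = 0) :
    hermiteOp (u + 1) (deriv f) = 0 := by
  funext x
  have h3 := congrFun (iteratedDeriv_hermiteOp u hf 1) x
  have e : ∀ k, iteratedDeriv k (deriv f) = iteratedDeriv (k + 1) f := fun k =>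
    iteratedDeriv_succ'.symm
  rw [h] at h3
  simp at h3
  simp only [hermiteOp, e, Pi.zero_apply]
  linear_combination -h3

/-- `∂ - x` maps solutions of parameter `u` to solutions of parameter `u - 1`. -/
theorem hermiteOp_deriv_sub_id_mul {u : ℂ} {f : ℂ → ℂ} (hf : Differentiable ℂ f)
    (h : hermiteOp u f = 0) : hermiteOp (u - 1) (fun x => deriv f x - x * f x) = 0 := by
  have d0 := fun x => (hf x).hasDerivAt
  have d1 : ∀ x, HasDerivAt (deriv f) (iteratedDeriv 2 f x) x := fun x => by
    simpa using hasDerivAt_iteratedDeriv_entire hf 1 x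
  have d2 := hasDerivAt_iteratedDeriv_entire hf 2
  funext x
  refine (hermiteOp_eq_of_hasDerivAt (u - 1)
    (fun x => (d1 x).sub ((hasDerivAt_id x).mul (d0 x)))
    (fun x => (d2 x).sub (((d0 x).const_mul 1).add ((hasDerivAt_id x).mul (d1 x)))) x).trans ?_
  have h2 := congrFun h x
  have h3 := congrFun (iteratedDeriv_hermiteOp u hf 1) x
  rw [h] at h3
  simp [hermiteOp] at h2 h3
  simp
  -- With L_u the Hermite operator, this is the intertwining relation L_{u-1}(∂ - x) = (∂ - x)L_u.
  linear_combination -h3 - x * h2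

/-! ### The functions `e^{x²/4} D_{-u}(x)` -/

/-- The function `e^{x²/4} D_{-u}(x)`. -/
noncomputable def weber (u x : ℂ) : ℂ :=
  (2 : ℂ) ^ (-u / 2) * (Real.sqrt Real.pi : ℂ) *
    (oneFOne (u / 2) (1 / 2) (x ^ 2 / 2) * (Complex.Gamma ((1 + u) / 2))⁻¹ -
      (Real.sqrt 2 : ℂ) * x * oneFOne ((1 + u) / 2) (3 / 2) (x ^ 2 / 2) *
        (Complex.Gamma (u / 2))⁻¹)

theorem exp_mul_parabolicCylinderD (u x : ℂ) :
    Complex.exp (x ^ 2 / 4) * parabolicCylinderD (-u) x = weber u x := by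
  have h : Complex.exp (x ^ 2 / 4) * Complex.exp (-x ^ 2 / 4) = 1 := by
    rw [← Complex.exp_add]; ring_nf; simp
  rw [parabolicCylinderD, weber, neg_neg, sub_neg_eq_add]
  linear_combination (2 : ℂ) ^ (-u / 2) * (Real.sqrt Real.pi : ℂ) *
    (oneFOne (u / 2) (1 / 2) (x ^ 2 / 2) * (Complex.Gamma ((1 + u) / 2))⁻¹ -
      (Real.sqrt 2 : ℂ) * x * oneFOne ((1 + u) / 2) (3 / 2) (x ^ 2 / 2) *
        (Complex.Gamma (u / 2))⁻¹) * h

theorem half_ne_neg_nat (n : ℕ) : (1 / 2 : ℂ) ≠ -(n : ℂ) := by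
  intro h
  have := congrArg Complex.re h
  simp at this
  linarith [(Nat.cast_nonneg n : (0 : ℝ) ≤ n)]

theorem three_halves_ne_neg_nat (n : ℕ) : (3 / 2 : ℂ) ≠ -(n : ℂ) := by
  intro h
  have := congrArg Complex.re h
  simp at this
  linarith [(Nat.cast_nonneg n : (0 : ℝ) ≤ n)]

/-- The derivative of `weber u`. -/
noncomputable def weberDeriv (u x : ℂ) : ℂ :=
  (2 : ℂ) ^ (-u / 2) * (Real.sqrt Real.pi : ℂ) *
    (x * iteratedDeriv 1 (oneFOne (u / 2) (1 / 2)) (x ^ 2 / 2) *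
        (Complex.Gamma ((1 + u) / 2))⁻¹ -
      (Real.sqrt 2 : ℂ) * (oneFOne ((1 + u) / 2) (3 / 2) (x ^ 2 / 2) +
        x * (x * iteratedDeriv 1 (oneFOne ((1 + u) / 2) (3 / 2)) (x ^ 2 / 2))) *
        (Complex.Gamma (u / 2))⁻¹)

theorem hasDerivAt_comp_sq_half {f : ℂ → ℂ} {f' x : ℂ} (hf : HasDerivAt f f' (x ^ 2 / 2)) :
    HasDerivAt (fun x : ℂ => f (x ^ 2 / 2)) (x * f') x := by
  have h : HasDerivAt (fun x : ℂ => x ^ 2 / 2) x x := by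
    simpa using ((hasDerivAt_id x).pow 2).div_const 2
  exact (hf.comp x h).congr_deriv (mul_comm _ _)

theorem hasDerivAt_weber (u x : ℂ) : HasDerivAt (weber u) (weberDeriv u x) x := by
  have hE := hasDerivAt_comp_sq_half (x := x)
    (hasDerivAt_iteratedDeriv_entire (differentiable_oneFOne half_ne_neg_nat (u / 2)) 0 _)
  have hO := hasDerivAt_comp_sq_half (x := x) (hasDerivAt_iteratedDeriv_entire
    (differentiable_oneFOne three_halves_ne_neg_nat ((1 + u) / 2)) 0 _)
  simp only [iteratedDeriv_zero] at hE hO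
  refine (((hE.mul_const _).sub ((((hasDerivAt_id x).const_mul (Real.sqrt 2 : ℂ)).mul
    hO).mul_const _)).const_mul _).congr_deriv ?_
  simp only [weberDeriv, id]
  ring

theorem differentiable_weber (u : ℂ) : Differentiable ℂ (weber u) :=
  fun x => (hasDerivAt_weber u x).differentiableAt

theorem deriv_weber_eq (u : ℂ) : deriv (weber u) = weberDeriv u :=
  funext fun x => (hasDerivAt_weber u x).deriv

/-- The substitution y = x²/2 turns Hermite's equation into Kummer's: parameters (u/2, 1/2) give the
even solution, and x times the function with parameters ((1+u)/2, 3/2) gives the odd one. -/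
theorem hermiteOp_weber (u : ℂ) : hermiteOp u (weber u) = 0 := by
  have hE1 := differentiable_oneFOne half_ne_neg_nat (u / 2)
  have hO1 := differentiable_oneFOne three_halves_ne_neg_nat ((1 + u) / 2)
  have h2 : ∀ x, HasDerivAt (weberDeriv u) ((2 : ℂ) ^ (-u / 2) * (Real.sqrt Real.pi : ℂ) *
    ((iteratedDeriv 1 (oneFOne (u / 2) (1 / 2)) (x ^ 2 / 2) +
      x ^ 2 * iteratedDeriv 2 (oneFOne (u / 2) (1 / 2)) (x ^ 2 / 2)) *
        (Complex.Gamma ((1 + u) / 2))⁻¹ -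
      (Real.sqrt 2 : ℂ) *
        (3 * x * iteratedDeriv 1 (oneFOne ((1 + u) / 2) (3 / 2)) (x ^ 2 / 2) +
        x ^ 3 * iteratedDeriv 2 (oneFOne ((1 + u) / 2) (3 / 2)) (x ^ 2 / 2)) *
        (Complex.Gamma (u / 2))⁻¹)) x := fun x => by
    have hE := hasDerivAt_comp_sq_half (x := x) (hasDerivAt_iteratedDeriv_entire hE1 1 _)
    have hO0 := hasDerivAt_comp_sq_half (x := x) (hasDerivAt_iteratedDeriv_entire hO1 0 _)
    have hO := hasDerivAt_comp_sq_half (x := x) (hasDerivAt_iteratedDeriv_entire hO1 1 _)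
    simp only [iteratedDeriv_zero] at hO0
    refine (((((hasDerivAt_id x).mul hE).mul_const _).sub (((hO0.add ((hasDerivAt_id x).mul
      ((hasDerivAt_id x).mul hO))).const_mul (Real.sqrt 2 : ℂ)).mul_const _)).const_mul
      _).congr_deriv ?_
    simp only [id, Pi.mul_apply]
    ring
  funext x
  rw [hermiteOp_eq_of_hasDerivAt u (hasDerivAt_weber u) h2]
  have kE := congrFun (kummerOp_oneFOne half_ne_neg_nat (u / 2)) (x ^ 2 / 2)
  have kO := congrFun (kummerOp_oneFOne three_halves_ne_neg_nat ((1 + u) / 2)) (x ^ 2 / 2)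
  simp only [kummerOp, Pi.zero_apply] at kE kO
  simp only [weberDeriv, weber, Pi.zero_apply]
  linear_combination (2 : ℂ) ^ (-u / 2) * (Real.sqrt Real.pi : ℂ) *
    (2 * (Complex.Gamma ((1 + u) / 2))⁻¹ * kE -
      2 * x * (Real.sqrt 2 : ℂ) * (Complex.Gamma (u / 2))⁻¹ * kO)

theorem weber_apply_zero (u : ℂ) :
    weber u 0 = (2 : ℂ) ^ (-u / 2) * (Real.sqrt Real.pi : ℂ) *
      (Complex.Gamma ((1 + u) / 2))⁻¹ := by
  have h := oneFOne_zero half_ne_neg_nat (u / 2)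
  rw [weber, show (0 : ℂ) ^ 2 / 2 = 0 by simp, h]
  ring

theorem deriv_weber_zero (u : ℂ) :
    deriv (weber u) 0 = -((2 : ℂ) ^ (-u / 2) * (Real.sqrt Real.pi : ℂ) *
      (Real.sqrt 2 : ℂ) * (Complex.Gamma (u / 2))⁻¹) := by
  rw [deriv_weber_eq]
  simp [weberDeriv, oneFOne_zero three_halves_ne_neg_nat]
  ring

theorem iteratedDeriv_two_weber_zero (u : ℂ) : iteratedDeriv 2 (weber u) 0 = u * weber u 0 := by
  have := congrFun (hermiteOp_weber u) 0
  simp only [hermiteOp, Pi.zero_apply] at this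
  linear_combination this

/-! ### Ladder relations, nonvanishing and Hermite values of `weber` -/

theorem sqrt_two_eq_cpow : (Real.sqrt 2 : ℂ) = (2 : ℂ) ^ (1 / 2 : ℂ) := by
  rw [Real.sqrt_eq_rpow, Complex.ofReal_cpow zero_le_two]
  simp

theorem two_cpow_mul_sqrt_two (w : ℂ) : (2 : ℂ) ^ w * (Real.sqrt 2 : ℂ) = 2 ^ (w + 1 / 2) := by
  rw [sqrt_two_eq_cpow, Complex.cpow_add _ _ two_ne_zero]

theorem sqrt_two_mul_self : (Real.sqrt 2 : ℂ) * (Real.sqrt 2 : ℂ) = 2 := by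
  rw [← Complex.ofReal_mul, Real.mul_self_sqrt zero_le_two]; simp

theorem two_cpow_neg_half_sub (u : ℂ) :
    (2 : ℂ) ^ (-(u - 1) / 2) = (2 : ℂ) ^ (-u / 2) * (Real.sqrt 2 : ℂ) := by
  rw [two_cpow_mul_sqrt_two]; ring_nf

theorem two_cpow_neg_half_add (u : ℂ) :
    (2 : ℂ) ^ (-u / 2) = (2 : ℂ) ^ (-(u + 1) / 2) * (Real.sqrt 2 : ℂ) := by
  rw [two_cpow_mul_sqrt_two]; ring_nf

/-- Both sides solve the equation with parameter u + 1, so initial data suffice. The identity 1/Γ(s)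
= s/Γ(s+1) holds at the poles as well, so no value of u is exceptional. -/
theorem deriv_weber (u : ℂ) : deriv (weber u) = -u • weber (u + 1) := by
  have hd := differentiable_weber u
  refine eq_smul_of_hermiteOp_eq_zero (differentiable_deriv_of_entire hd)
    (differentiable_weber _) _ (hermiteOp_deriv hd (hermiteOp_weber u)) (hermiteOp_weber _) ?_ ?_
  · rw [deriv_weber_zero, weber_apply_zero, two_cpow_neg_half_add u,
      Complex.one_div_Gamma_eq_self_mul_one_div_Gamma_add_one (u / 2),
      show (1 + (u + 1)) / 2 = u / 2 + 1 by ring]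
    linear_combination -(2 : ℂ) ^ (-(u + 1) / 2) * (Real.sqrt Real.pi : ℂ) *
      (u / 2 * (Complex.Gamma (u / 2 + 1))⁻¹) * sqrt_two_mul_self
  · have h2 : deriv (deriv (weber u)) 0 = iteratedDeriv 2 (weber u) 0 := by
      rw [iteratedDeriv_succ, iteratedDeriv_one]
    rw [h2, iteratedDeriv_two_weber_zero, deriv_weber_zero, weber_apply_zero,
      two_cpow_neg_half_add u, add_comm 1 u]
    ring

theorem deriv_weber_sub (u : ℂ) :
    (fun x => deriv (weber u) x - x * weber u x) = (-1 : ℂ) • weber (u - 1) := by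
  have hd := differentiable_weber u
  have hd' := differentiable_deriv_of_entire hd
  refine eq_smul_of_hermiteOp_eq_zero (hd'.sub (differentiable_id.mul hd))
    (differentiable_weber _) _ (hermiteOp_deriv_sub_id_mul hd (hermiteOp_weber u))
    (hermiteOp_weber _) ?_ ?_
  · change deriv (weber u) 0 - 0 * weber u 0 = _
    rw [deriv_weber_zero, weber_apply_zero (u - 1), two_cpow_neg_half_sub,
      show (1 + (u - 1)) / 2 = u / 2 by ring]
    ring
  · have h2 : deriv (deriv (weber u)) 0 = iteratedDeriv 2 (weber u) 0 := by
      rw [iteratedDeriv_succ, iteratedDeriv_one]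
    refine ((hd' 0).hasDerivAt.sub ((hasDerivAt_id (0 : ℂ)).mul (hd 0).hasDerivAt)).deriv.trans ?_
    simp only [id]
    rw [h2, iteratedDeriv_two_weber_zero, deriv_weber_zero (u - 1), weber_apply_zero,
      two_cpow_neg_half_sub, show (1 + u) / 2 = (u - 1) / 2 + 1 by ring,
      Complex.one_div_Gamma_eq_self_mul_one_div_Gamma_add_one ((u - 1) / 2)]
    simp only [one_mul, zero_mul, add_zero]
    linear_combination -(2 : ℂ) ^ (-u / 2) * (Real.sqrt Real.pi : ℂ) *
      ((u - 1) / 2 * (Complex.Gamma ((u - 1) / 2 + 1))⁻¹) * sqrt_two_mul_self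

/-- Eliminating the derivative between the two ladder relations at u + 1 gives this three-term
relation. -/
theorem weber_recurrence (u x : ℂ) :
    weber u x = x * weber (u + 1) x + (u + 1) * weber (u + 2) x := by
  have h := congrFun (deriv_weber_sub (u + 1)) x
  rw [deriv_weber] at h
  simp only [Pi.smul_apply, smul_eq_mul, add_sub_cancel_right] at h
  rw [show u + 1 + 1 = u + 2 by ring] at h
  linear_combination h

/-- This reduces the growth of all derivatives to the growth of the functions themselves at shifted
parameters. -/
theorem iteratedDeriv_weber (p : ℕ) :
    ∀ u : ℂ, ∃ r : ℂ, iteratedDeriv p (weber u) = r • weber (u + p) := by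
  induction p with
  | zero => exact fun u => ⟨1, by simp⟩
  | succ p ih =>
    intro u
    obtain ⟨r, hr⟩ := ih u
    refine ⟨r * -(u + p), ?_⟩
    rw [iteratedDeriv_succ, hr]
    funext x
    rw [deriv_const_smul _ (differentiable_weber _ x), deriv_weber]
    simp [mul_assoc, add_assoc]

/-- The two initial values vanish together only if (1+u)/2 and u/2 are both poles of Γ, which parity
excludes. -/
theorem weber_ne_zero (u : ℂ) : weber u ≠ 0 := by
  intro h
  have h0 := weber_apply_zero u
  have h1 := deriv_weber_zero u
  have hpi : (Real.sqrt Real.pi : ℂ) ≠ 0 := by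
    exact_mod_cast (Real.sqrt_pos.2 Real.pi_pos).ne'
  have h2 : (Real.sqrt 2 : ℂ) ≠ 0 := by exact_mod_cast (Real.sqrt_pos.2 zero_lt_two).ne'
  rw [h] at h0 h1
  have hd : deriv (0 : ℂ → ℂ) 0 = 0 := by simp
  rw [hd] at h1
  have g0 : Complex.Gamma ((1 + u) / 2) = 0 := by
    by_contra hg
    exact mul_ne_zero (mul_ne_zero (by simp [Complex.cpow_eq_zero_iff]) hpi) (inv_ne_zero hg)
      h0.symm
  have g1 : Complex.Gamma (u / 2) = 0 := by
    by_contra hg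
    exact neg_ne_zero.2 (mul_ne_zero (mul_ne_zero (mul_ne_zero
      (by simp [Complex.cpow_eq_zero_iff]) hpi) h2) (inv_ne_zero hg)) h1.symm
  rw [Complex.Gamma_eq_zero_iff] at g0 g1
  obtain ⟨m, hm⟩ := g0
  obtain ⟨n, hn⟩ := g1
  have : (1 : ℂ) + 2 * m = 2 * n := by linear_combination 2 * hm - 2 * hn
  have : 1 + 2 * m = 2 * n := by exact_mod_cast this
  omega

theorem weber_zero : weber 0 = 1 := by
  have h0 : ∀ x, HasDerivAt (weber 0) 0 x := fun x => by
    have := (differentiable_weber 0 x).hasDerivAt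
    rw [deriv_weber] at this
    simpa using this
  have hs : (Real.pi : ℂ) ^ (1 / 2 : ℂ) = (Real.sqrt Real.pi : ℂ) := by
    rw [Real.sqrt_eq_rpow, Complex.ofReal_cpow Real.pi_pos.le]
    simp
  have hpi : (Real.sqrt Real.pi : ℂ) ≠ 0 := by
    exact_mod_cast (Real.sqrt_pos.2 Real.pi_pos).ne'
  funext x
  rw [is_const_of_deriv_eq_zero (differentiable_weber 0) (fun x => (h0 x).deriv) x 0,
    weber_apply_zero, add_zero, Complex.Gamma_one_half_eq, hs]
  simp [hpi]

theorem weber_neg_nat (n : ℕ) (x : ℂ) :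
    weber (-(n : ℂ)) x = Polynomial.aeval x (Polynomial.hermite n) := by
  have key : weber (-(n : ℂ)) = fun x => Polynomial.aeval x (Polynomial.hermite n) := by
    induction n with
    | zero => funext x; simp [weber_zero]
    | succ n ih =>
      funext x
      have h := congrFun (deriv_weber_sub (-(n : ℂ))) x
      have hd : deriv (weber (-(n : ℂ))) x =
          Polynomial.aeval x (Polynomial.derivative (Polynomial.hermite n)) := by
        rw [ih, Polynomial.deriv_aeval]
      simp only [Pi.smul_apply, smul_eq_mul] at h
      rw [hd, ih] at h
      -- The recursion He_{n+1} = x He_n - He_n' is the ladder relation for ∂ - x up to sign.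
      rw [Polynomial.hermite_succ, Nat.cast_succ, neg_add', map_sub, map_mul, Polynomial.aeval_X]
      linear_combination h
  rw [key]

/-! ### An integral representation of `e^{x²/4} D_{-u}(x)` -/

section WeberIntegral

open MeasureTheory Set

/-- The integrand `t^{u-1} e^{-xt - t²/2}`. -/
noncomputable def weberKernel (u x : ℂ) (t : ℝ) : ℂ :=
  (t : ℂ) ^ (u - 1) * Complex.exp (-x * t - t ^ 2 / 2)

theorem continuousOn_weberKernel (u x : ℂ) : ContinuousOn (weberKernel u x) (Ioi 0) := by
  refine ContinuousOn.mul (fun t ht => ?_) (Continuous.continuousOn (by fun_prop))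
  exact (Complex.continuousAt_ofReal_cpow_const t _
    (Or.inr (ne_of_gt ht))).continuousWithinAt

theorem aestronglyMeasurable_weberKernel (u x : ℂ) :
    AEStronglyMeasurable (weberKernel u x) (volume.restrict (Ioi 0)) :=
  (continuousOn_weberKernel u x).aestronglyMeasurable measurableSet_Ioi

/-- Completing the square gives bt - t²/2 ≤ b² - t²/4. The bound depends only on b, hence serves as
a dominating function on a whole disc of values of x. -/
theorem norm_weberKernel_le (u : ℂ) {x : ℂ} {b t : ℝ} (hx : ‖x‖ ≤ b) (ht : 0 < t) :
    ‖weberKernel u x t‖ ≤ Real.exp (b ^ 2) * (t ^ (u.re - 1) * Real.exp (-(1 / 4) * t ^ 2)) := by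
  have hre : (-x * (t : ℂ) - (t : ℂ) ^ 2 / 2).re = -x.re * t - t ^ 2 / 2 := by
    rw [← Complex.ofReal_pow, show ((t ^ 2 : ℝ) : ℂ) / 2 = ((t ^ 2 / 2 : ℝ) : ℂ) by push_cast; rfl,
      Complex.sub_re, Complex.ofReal_re, Complex.re_mul_ofReal, Complex.neg_re]
  rw [weberKernel, norm_mul, Complex.norm_cpow_eq_rpow_re_of_pos ht, Complex.norm_exp, hre,
    Complex.sub_re, Complex.one_re, mul_left_comm, ← Real.exp_add]
  refine mul_le_mul_of_nonneg_left (Real.exp_le_exp.2 ?_) (Real.rpow_nonneg ht.le _)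
  have h1 : -x.re ≤ b := (neg_le_abs _).trans ((Complex.abs_re_le_norm x).trans hx)
  nlinarith [mul_le_mul_of_nonneg_right h1 ht.le, sq_nonneg (t / 2 - b)]

theorem integrableOn_weberBound {s : ℝ} (hs : 0 < s) (r : ℝ) :
    IntegrableOn (fun t : ℝ => r * (t ^ (s - 1) * Real.exp (-(1 / 4) * t ^ 2))) (Ioi 0) :=
  (integrableOn_rpow_mul_exp_neg_mul_sq (by norm_num) (by linarith)).const_mul r

theorem integrableOn_weberKernel {u : ℂ} (hu : 0 < u.re) (x : ℂ) :
    IntegrableOn (weberKernel u x) (Ioi 0) := by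
  refine (integrableOn_weberBound hu (Real.exp (‖x‖ ^ 2))).mono'
    (aestronglyMeasurable_weberKernel u x) ?_
  filter_upwards [ae_restrict_mem measurableSet_Ioi] with t ht
  exact norm_weberKernel_le u le_rfl ht

theorem ofReal_mul_weberKernel (u x : ℂ) {t : ℝ} (ht : 0 < t) :
    t * weberKernel u x t = weberKernel (u + 1) x t := by
  have h : (t : ℂ) ^ (u + 1 - 1) = (t : ℂ) ^ (u - 1) * t := by
    rw [show u + 1 - 1 = (u - 1) + 1 by ring, Complex.cpow_add _ _ (by exact_mod_cast ht.ne'),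
      Complex.cpow_one]
  rw [weberKernel, weberKernel, h]
  ring

/-- The integral `∫₀^∞ t^{u-1} e^{-xt - t²/2} dt`. -/
noncomputable def weberIntegral (u x : ℂ) : ℂ := ∫ t in Ioi (0 : ℝ), weberKernel u x t

theorem hasDerivAt_weberIntegral {u : ℂ} (hu : 0 < u.re) (x : ℂ) :
    HasDerivAt (weberIntegral u) (-weberIntegral (u + 1) x) x := by
  have hu' : 0 < (u + 1).re := by simp; linarith
  rw [weberIntegral, ← integral_neg]
  refine (hasDerivAt_integral_of_dominated_loc_of_deriv_le
    (F := weberKernel u) (F' := fun x t => -weberKernel (u + 1) x t)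
    (bound := fun t => Real.exp ((‖x‖ + 1) ^ 2) *
      (t ^ ((u + 1).re - 1) * Real.exp (-(1 / 4) * t ^ 2)))
    (Metric.ball_mem_nhds x one_pos)
    (Eventually.of_forall fun y => aestronglyMeasurable_weberKernel u y)
    (integrableOn_weberKernel hu x) (aestronglyMeasurable_weberKernel _ x).neg ?_
    (integrableOn_weberBound hu' _) ?_).2
  · filter_upwards [ae_restrict_mem measurableSet_Ioi] with t ht y hy
    rw [norm_neg]
    refine norm_weberKernel_le _ ?_ ht
    have h1 : ‖y - x‖ < 1 := by simpa [dist_eq_norm] using hy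
    have h2 := norm_sub_norm_le y x
    linarith
  · filter_upwards [ae_restrict_mem measurableSet_Ioi] with t ht y _
    rw [← ofReal_mul_weberKernel u y ht]
    have h : HasDerivAt (fun y : ℂ => -y * (t : ℂ) - (t : ℂ) ^ 2 / 2) (-1 * (t : ℂ)) y :=
      ((hasDerivAt_id y).neg.mul_const (t : ℂ)).sub_const ((t : ℂ) ^ 2 / 2)
    refine (h.cexp.const_mul _).congr_deriv ?_
    rw [weberKernel]
    ring

theorem differentiable_weberIntegral {u : ℂ} (hu : 0 < u.re) :
    Differentiable ℂ (weberIntegral u) :=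
  fun x => (hasDerivAt_weberIntegral hu x).differentiableAt

theorem hasDerivAt_weberKernel_add_one {u : ℂ} (hu : u ≠ 0) (x : ℂ) {t : ℝ} (ht : 0 < t) :
    HasDerivAt (weberKernel (u + 1) x)
      (u * weberKernel u x t - x * weberKernel (u + 1) x t - weberKernel (u + 2) x t) t := by
  have h0 : HasDerivAt (fun s : ℝ => (s : ℂ) ^ (u + 1 - 1)) (u * (t : ℂ) ^ (u - 1)) t := by
    rw [add_sub_cancel_right]
    exact hasDerivAt_ofReal_cpow_const ht.ne' hu
  have h1 : HasDerivAt (fun s : ℝ => -x * (s : ℂ) - (s : ℂ) ^ 2 / 2) (-x - t) t := by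
    have h : HasDerivAt (fun s : ℂ => -x * s - s ^ 2 / 2) (-x - t) (t : ℂ) := by
      refine (((hasDerivAt_id (t : ℂ)).const_mul (-x)).sub
        (((hasDerivAt_id (t : ℂ)).pow 2).div_const 2)).congr_deriv ?_
      simp
    exact h.comp_ofReal
  have e : weberKernel (u + 2) x t = t * weberKernel (u + 1) x t := by
    rw [ofReal_mul_weberKernel _ _ ht]; ring_nf
  refine (h0.mul h1.cexp).congr_deriv ?_
  rw [e]
  simp only [weberKernel]
  ring

/-- The integrand is the total derivative of t^u e^{-xt-t²/2}. The boundary term at 0 vanishes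
because Re u > 0. Since differentiation in x sends the integral at u to minus the one at u + 1, this
is Hermite's equation. -/
theorem weberIntegral_recurrence {u : ℂ} (hu : 0 < u.re) (x : ℂ) :
    u * weberIntegral u x - x * weberIntegral (u + 1) x - weberIntegral (u + 2) x = 0 := by
  have hu0 : u ≠ 0 := fun h => by simp [h] at hu
  have hi0 := (integrableOn_weberKernel hu x).const_mul u
  have hi1 := integrableOn_weberKernel (u := u + 1) (by simp; linarith) x
  have hi1' := hi1.const_mul x
  have hi2 := integrableOn_weberKernel (u := u + 2) (by simp; linarith) x
  have hd := fun t (ht : t ∈ Ioi (0 : ℝ)) => hasDerivAt_weberKernel_add_one hu0 x ht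
  have hcont : ContinuousWithinAt (weberKernel (u + 1) x) (Ici 0) 0 := by
    refine ContinuousAt.continuousWithinAt (ContinuousAt.mul ?_ (by fun_prop))
    exact Complex.continuousAt_ofReal_cpow_const 0 _ (Or.inl (by simpa using hu))
  -- The limit at infinity is 0 because the function and its derivative are both integrable.
  have h := integral_Ioi_of_hasDerivAt_of_tendsto hcont hd ((hi0.sub hi1').sub hi2)
    (tendsto_zero_of_hasDerivAt_of_integrableOn_Ioi hd ((hi0.sub hi1').sub hi2) hi1)
  have hz : weberKernel (u + 1) x 0 = 0 := by simp [weberKernel, hu0]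
  rw [hz, sub_zero] at h
  have e1 := integral_sub (hi0.sub hi1') hi2
  have e2 := integral_sub hi0 hi1'
  simp only [weberIntegral, ← integral_const_mul]
  rw [← e2, ← h]
  exact e1.symm

theorem hermiteOp_weberIntegral {u : ℂ} (hu : 0 < u.re) : hermiteOp u (weberIntegral u) = 0 := by
  funext x
  rw [hermiteOp_eq_of_hasDerivAt u (hasDerivAt_weberIntegral hu)
    (fun y => (hasDerivAt_weberIntegral (u := u + 1) (by simp; linarith) y).neg)]
  have := weberIntegral_recurrence hu x
  rw [show u + 1 + 1 = u + 2 by ring, Pi.zero_apply]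
  linear_combination -this

/-- The substitution s = t² turns the integral into Euler's integral for Γ(u/2). -/
theorem weberIntegral_zero {u : ℂ} (hu : 0 < u.re) :
    weberIntegral u 0 = 2 ^ (u / 2 - 1) * Complex.Gamma (u / 2) := by
  have h := mellin_comp_rpow (fun t : ℝ => Complex.exp (-((1 / 2 : ℝ) : ℂ) * t)) u 2
  have h1 : mellin (fun t : ℝ => Complex.exp (-((1 / 2 : ℝ) : ℂ) * ((t ^ (2 : ℝ) : ℝ) : ℂ))) u =
      weberIntegral u 0 := by
    rw [mellin, weberIntegral]
    refine setIntegral_congr_fun measurableSet_Ioi fun t _ => ?_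
    simp only [weberKernel, smul_eq_mul, Real.rpow_two]
    congr 2
    push_cast
    ring
  have h2 := Complex.integral_cpow_mul_exp_neg_mul_Ioi (a := u / 2) (r := 1 / 2)
    (by simpa using hu) (by norm_num)
  rw [h1] at h
  rw [h, mellin]
  simp only [smul_eq_mul, neg_mul] at h2 ⊢
  push_cast at h2 ⊢
  rw [h2, Complex.cpow_sub _ _ two_ne_zero]
  simp
  ring

/-- Both sides solve Hermite's equation. Their values and derivatives at 0 agree by Legendre's
duplication formula. -/
theorem weberIntegral_eq {u : ℂ} (hu : 0 < u.re) :
    weberIntegral u = Complex.Gamma u • weber u := by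
  have hpi : (Real.sqrt Real.pi : ℂ) ≠ 0 := by
    exact_mod_cast (Real.sqrt_pos.2 Real.pi_pos).ne'
  have g1 : Complex.Gamma (u / 2) ≠ 0 := Complex.Gamma_ne_zero_of_re_pos (by simpa using hu)
  have g2 : Complex.Gamma ((u + 1) / 2) ≠ 0 :=
    Complex.Gamma_ne_zero_of_re_pos (by simp; linarith)
  have dup := Complex.Gamma_mul_Gamma_add_half (u / 2)
  rw [show u / 2 + 1 / 2 = (u + 1) / 2 by ring, mul_div_cancel₀ u two_ne_zero] at dup
  have p1 : (2 : ℂ) ^ (u / 2 - 1) * 2 ^ (1 - u) = 2 ^ (-u / 2) := by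
    rw [← Complex.cpow_add _ _ two_ne_zero]; ring_nf
  have p2 : (2 : ℂ) ^ ((u + 1) / 2 - 1) * 2 ^ (1 - u) = 2 ^ (-u / 2) * (Real.sqrt 2 : ℂ) := by
    rw [two_cpow_mul_sqrt_two, ← Complex.cpow_add _ _ two_ne_zero]; ring_nf
  refine eq_smul_of_hermiteOp_eq_zero (differentiable_weberIntegral hu) (differentiable_weber u)
    _ (hermiteOp_weberIntegral hu) (hermiteOp_weber u) ?_ ?_
  · rw [weberIntegral_zero hu, weber_apply_zero, add_comm 1 u, ← p1]
    generalize (2 : ℂ) ^ (u / 2 - 1) = p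
    field_simp
    linear_combination p * dup
  · rw [(hasDerivAt_weberIntegral hu 0).deriv, weberIntegral_zero (by simp; linarith),
      deriv_weber_zero]
    generalize (2 : ℂ) ^ ((u + 1) / 2 - 1) = p at *
    generalize (2 : ℂ) ^ (-u / 2) = q at *
    field_simp
    linear_combination -p * dup -
      Complex.Gamma u * (Real.sqrt Real.pi : ℂ) * p2

/-! ### Asymptotics at infinity -/

theorem norm_exp_neg_sq_half_sub_one_le (t : ℝ) :
    ‖Complex.exp (-(t : ℂ) ^ 2 / 2) - 1‖ ≤ t ^ 2 / 2 := by
  have h : Complex.exp (-(t : ℂ) ^ 2 / 2) - 1 = ((Real.exp (-t ^ 2 / 2) - 1 : ℝ) : ℂ) := by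
    push_cast; rfl
  have h1 := Real.add_one_le_exp (-t ^ 2 / 2)
  have h2 : Real.exp (-t ^ 2 / 2) ≤ 1 := Real.exp_le_one_iff.2 (by nlinarith [sq_nonneg t])
  rw [h, Complex.norm_real, Real.norm_eq_abs, abs_of_nonpos (by linarith)]
  linarith

/-- Replacing e^{-t²/2} by 1 leaves Euler's integral Γ(u)x^{-u}. The error factor is at most t²/2,
which raises the exponent by two and gives the remainder. -/
theorem norm_weberIntegral_sub_le {u : ℂ} (hu : 0 < u.re) {x : ℝ} (hx : 0 < x) :
    ‖weberIntegral u x - Complex.Gamma u * (x : ℂ) ^ (-u)‖ ≤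
      Real.Gamma (u.re + 2) / 2 * x ^ (-u.re - 2) := by
  have hG := Complex.integral_cpow_mul_exp_neg_mul_Ioi (a := u) (r := x) hu (by simpa using hx)
  have hGr := Real.integral_rpow_mul_exp_neg_mul_Ioi (a := u.re + 2) (r := x) (by linarith) hx
  have hx0 : (x : ℂ) ≠ 0 := by exact_mod_cast hx.ne'
  have e1 : (1 / (x : ℂ)) ^ u = (x : ℂ) ^ (-u) := by
    rw [one_div, Complex.cpow_neg, Complex.inv_cpow]
    rw [Complex.arg_ofReal_of_nonneg hx.le]
    exact Real.pi_pos.ne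
  have e2 : (1 / x) ^ (u.re + 2) = x ^ (-u.re - 2) := by
    rw [one_div, Real.inv_rpow hx.le, ← Real.rpow_neg hx.le]; ring_nf
  have hint : IntegrableOn (fun t : ℝ => (t : ℂ) ^ (u - 1) * Complex.exp (-(x * t))) (Ioi 0) := by
    -- A non-integrable function has integral 0 by convention, whereas the known value of this
    -- integral is nonzero.
    by_contra hn
    rw [integral_undef hn] at hG
    exact mul_ne_zero (by rw [e1]; simp [Complex.cpow_eq_zero_iff, hx0])
      (Complex.Gamma_ne_zero_of_re_pos hu) hG.symm
  have hintr : IntegrableOn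
      (fun t : ℝ => t ^ (u.re + 2 - 1) * Real.exp (-(x * t))) (Ioi 0) := by
    by_contra hn
    rw [integral_undef hn] at hGr
    exact mul_ne_zero (Real.rpow_pos_of_pos (by positivity) _).ne'
      (Real.Gamma_pos_of_pos (by linarith)).ne' hGr.symm
  rw [e1] at hG
  rw [e2] at hGr
  rw [mul_comm (Complex.Gamma u), ← hG, weberIntegral,
    ← integral_sub (integrableOn_weberKernel hu x) hint,
    show Real.Gamma (u.re + 2) / 2 * x ^ (-u.re - 2) =
      1 / 2 * (x ^ (-u.re - 2) * Real.Gamma (u.re + 2)) by ring, ← hGr, ← integral_const_mul]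
  refine norm_integral_le_of_norm_le (hintr.const_mul (1 / 2)) ?_
  filter_upwards [ae_restrict_mem measurableSet_Ioi] with t ht
  have ht : 0 < t := ht
  have e3 : weberKernel u x t - (t : ℂ) ^ (u - 1) * Complex.exp (-(x * t)) =
      (t : ℂ) ^ (u - 1) * Complex.exp (-(x * t)) * (Complex.exp (-(t : ℂ) ^ 2 / 2) - 1) := by
    rw [weberKernel, mul_sub, mul_assoc _ (Complex.exp _) (Complex.exp _), ← Complex.exp_add]
    ring_nf
  have e4 : ‖Complex.exp (-((x : ℂ) * t))‖ = Real.exp (-(x * t)) := by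
    rw [Complex.norm_exp]; simp
  have e5 : t ^ (u.re + 2 - 1) = t ^ (u.re - 1) * t ^ 2 := by
    rw [← Real.rpow_two, ← Real.rpow_add ht]; ring_nf
  rw [e3, norm_mul, norm_mul, Complex.norm_cpow_eq_rpow_re_of_pos ht, e4, e5, Complex.sub_re,
    Complex.one_re]
  refine (mul_le_mul_of_nonneg_left (norm_exp_neg_sq_half_sub_one_le t) (by positivity)).trans
    (le_of_eq ?_)
  ring

end WeberIntegral

/-- The asymptotic relation `e^{x²/4} D_{-u}(x) = x^{-u} + O(x^{-u-2})` as `x → +∞`. -/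
def WeberAsymptotic (u : ℂ) : Prop :=
  (fun x : ℝ => weber u x - (x : ℂ) ^ (-u)) =O[atTop] fun x : ℝ => (x : ℂ) ^ (-u - 2)

theorem weberAsymptotic_of_re_pos {u : ℂ} (hu : 0 < u.re) : WeberAsymptotic u := by
  have hg : Complex.Gamma u ≠ 0 := Complex.Gamma_ne_zero_of_re_pos hu
  refine IsBigO.of_bound (Real.Gamma (u.re + 2) / 2 / ‖Complex.Gamma u‖) ?_
  filter_upwards [eventually_gt_atTop 0] with x hx
  have h := norm_weberIntegral_sub_le hu hx
  rw [weberIntegral_eq hu, Pi.smul_apply, smul_eq_mul, ← mul_sub, norm_mul] at h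
  rw [Complex.norm_cpow_eq_rpow_re_of_pos hx, div_mul_eq_mul_div,
    le_div_iff₀ (norm_pos_iff.2 hg), mul_comm]
  simpa using h

theorem isBigO_cpow_of_re_le {v w : ℂ} (h : v.re ≤ w.re) :
    (fun x : ℝ => (x : ℂ) ^ v) =O[atTop] fun x : ℝ => (x : ℂ) ^ w := by
  refine IsBigO.of_bound 1 ?_
  filter_upwards [eventually_ge_atTop 1] with x hx
  have hx0 : 0 < x := one_pos.trans_le hx
  rw [one_mul, Complex.norm_cpow_eq_rpow_re_of_pos hx0, Complex.norm_cpow_eq_rpow_re_of_pos hx0]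
  exact Real.rpow_le_rpow_of_exponent_le hx h

theorem WeberAsymptotic.isBigO {u : ℂ} (h : WeberAsymptotic u) :
    (fun x : ℝ => weber u x) =O[atTop] fun x : ℝ => (x : ℂ) ^ (-u) := by
  have := (IsBigO.trans h (isBigO_cpow_of_re_le (w := -u) (by simp))).add (isBigO_refl _ _)
  simpa using this

/-- In the three-term recurrence, x times the function at u + 1 carries the leading term x^{-u},
while the function at u + 2 is already of the order of the remainder. -/
theorem WeberAsymptotic.of_add {u : ℂ} (h1 : WeberAsymptotic (u + 1))
    (h2 : WeberAsymptotic (u + 2)) : WeberAsymptotic u := by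
  have hmul : ∀ w : ℂ, ∀ᶠ x : ℝ in atTop, (x : ℂ) * (x : ℂ) ^ w = (x : ℂ) ^ (w + 1) := fun w => by
    filter_upwards [eventually_gt_atTop 0] with x hx
    rw [Complex.cpow_add _ _ (by exact_mod_cast hx.ne'), Complex.cpow_one, mul_comm]
  have e1 : (fun x : ℝ => (x : ℂ) * (weber (u + 1) x - (x : ℂ) ^ (-(u + 1)))) =O[atTop]
      fun x : ℝ => (x : ℂ) ^ (-u - 2) := by
    refine ((isBigO_refl (fun x : ℝ => (x : ℂ)) atTop).mul h1).congr' EventuallyEq.rfl ?_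
    filter_upwards [hmul (-(u + 1) - 2)] with x hx
    rw [hx]
    ring_nf
  have e2 : (fun x : ℝ => (u + 1) * weber (u + 2) x) =O[atTop]
      fun x : ℝ => (x : ℂ) ^ (-u - 2) := by
    have := h2.isBigO.const_mul_left (u + 1)
    rwa [neg_add'] at this
  refine (e1.add e2).congr' ?_ EventuallyEq.rfl
  filter_upwards [hmul (-(u + 1))] with x hx
  rw [show -(u + 1) + 1 = -u by ring] at hx
  rw [weber_recurrence u x, ← hx]
  ring

theorem weberAsymptotic (u : ℂ) : WeberAsymptotic u := by
  -- Each application of the recurrence extends the half-plane of validity by one unit to the left.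
  have key : ∀ n : ℕ, ∀ u : ℂ, -(n : ℝ) < u.re → WeberAsymptotic u := by
    intro n
    induction n with
    | zero => exact fun u hu => weberAsymptotic_of_re_pos (by simpa using hu)
    | succ n ih =>
      intro u hu
      push_cast at hu
      exact (ih (u + 1) (by simp; linarith)).of_add (ih (u + 2) (by simp; linarith))
  obtain ⟨n, hn⟩ := exists_nat_gt (-u.re)
  exact key n u (by linarith)

theorem weber_mem_polyGrowthFun (u : ℂ) : weber u ∈ polyGrowthFun := by
  refine ⟨differentiable_weber u, fun p => ?_⟩
  obtain ⟨r, hr⟩ := iteratedDeriv_weber p u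
  obtain ⟨N, hN⟩ := exists_nat_ge (-(u + p).re)
  refine ⟨N, ?_⟩
  rw [hr]
  have h := ((weberAsymptotic (u + p)).isBigO.trans
    (isBigO_cpow_of_re_le (w := (N : ℂ)) (by simpa using hN))).const_mul_left r
  refine h.trans (IsBigO.of_bound 1 (Eventually.of_forall fun x => ?_))
  simp

/-! ### Null spaces and string conditions -/

/-- The Wronskian W of two solutions satisfies W' = xW, so W e^{-x²/2} is constant. Polynomial
growth of the functions and their first derivatives makes this product tend to 0 along the positive
axis, so W(0) = 0 and the initial data are proportional. -/
theorem eq_smul_weber {u : ℂ} {f : ℂ → ℂ} (hf : f ∈ polyGrowthFun) (h : hermiteOp u f = 0) :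
    ∃ r : ℂ, r • weber u = f := by
  have hg := weber_mem_polyGrowthFun u
  have hfd := hf.1
  have hgd := hg.1
  have d1 : ∀ {f : ℂ → ℂ}, Differentiable ℂ f → ∀ x,
      HasDerivAt (deriv f) (iteratedDeriv 2 f x) x := fun {f} hf x => by
    simpa using hasDerivAt_iteratedDeriv_entire hf 1 x
  set W : ℂ → ℂ := fun x => f x * deriv (weber u) x - deriv f x * weber u x with hW
  have hWd : ∀ x, HasDerivAt (fun x => W x * Complex.exp (-(x ^ 2 / 2))) 0 x := fun x => by
    have hsq : HasDerivAt (fun x : ℂ => -(x ^ 2 / 2)) (-x) x := by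
      refine (((hasDerivAt_id x).pow 2).div_const 2).neg.congr_deriv ?_
      simp
    refine (((((hfd x).hasDerivAt.mul (d1 hgd x)).sub
      ((d1 hfd x).mul (hgd x).hasDerivAt))).mul hsq.cexp).congr_deriv ?_
    have e1 := congrFun h x
    have e2 := congrFun (hermiteOp_weber u) x
    simp only [hermiteOp, iteratedDeriv_one, Pi.zero_apply] at e1 e2
    simp only [Pi.sub_apply, Pi.mul_apply]
    linear_combination Complex.exp (-(x ^ 2 / 2)) * (f x * e2 - weber u x * e1)
  have hconst : ∀ x, W x * Complex.exp (-(x ^ 2 / 2)) = W 0 := fun x => by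
    have := is_const_of_deriv_eq_zero (fun x => (hWd x).differentiableAt)
      (fun x => (hWd x).deriv) x 0
    simpa using this
  obtain ⟨n0, hn0⟩ := hf.2 0
  obtain ⟨n1, hn1⟩ := hf.2 1
  obtain ⟨m0, hm0⟩ := hg.2 0
  obtain ⟨m1, hm1⟩ := hg.2 1
  simp only [iteratedDeriv_zero, iteratedDeriv_one] at hn0 hn1 hm0 hm1
  have hexp : (fun x : ℝ => Complex.exp (-((x : ℂ) ^ 2 / 2))) =O[atTop]
      fun x : ℝ => Real.exp (-x) := by
    refine IsBigO.of_bound 1 ?_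
    filter_upwards [eventually_ge_atTop 2] with x hx
    have e : -((x : ℂ) ^ 2 / 2) = ((-(x ^ 2 / 2) : ℝ) : ℂ) := by push_cast; rfl
    rw [e, ← Complex.ofReal_exp, Complex.norm_real, Real.norm_eq_abs, Real.norm_eq_abs,
      Real.abs_exp, Real.abs_exp, one_mul]
    exact Real.exp_le_exp.2 (by nlinarith)
  have hlim : ∀ n : ℕ, Tendsto (fun x : ℝ => x ^ n * Real.exp (-x)) atTop (nhds 0) :=
    Real.tendsto_pow_mul_exp_neg_atTop_nhds_zero
  have t1 := ((hn0.mul hm1).mul hexp).trans_tendsto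
    (by simpa only [← pow_add] using hlim (n0 + m1))
  have t2 := ((hn1.mul hm0).mul hexp).trans_tendsto
    (by simpa only [← pow_add] using hlim (n1 + m0))
  have hW0 : W 0 = 0 := by
    refine tendsto_nhds_unique (f := fun _ : ℝ => W 0) (l := atTop) tendsto_const_nhds ?_
    have := t1.sub t2
    rw [sub_zero] at this
    refine this.congr fun x => ?_
    rw [← hconst x]
    simp only [hW]
    ring
  have hdet : f 0 * deriv (weber u) 0 = deriv f 0 * weber u 0 := sub_eq_zero.1 hW0
  -- The proportionality factor is read off from whichever initial value of `weber u` is nonzero;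
  -- they cannot both vanish.
  by_cases hz : weber u 0 = 0
  · have hz' : deriv (weber u) 0 ≠ 0 := fun h' =>
      weber_ne_zero u (eq_zero_of_hermiteOp_eq_zero hgd (hermiteOp_weber u) hz h')
    refine ⟨deriv f 0 / deriv (weber u) 0,
      (eq_smul_of_hermiteOp_eq_zero hfd hgd _ h (hermiteOp_weber u) ?_ ?_).symm⟩
    · rw [hz, mul_zero] at hdet ⊢
      exact (mul_eq_zero.1 hdet).resolve_right hz'
    · field_simp
  · refine ⟨f 0 / weber u 0,
      (eq_smul_of_hermiteOp_eq_zero hfd hgd _ h (hermiteOp_weber u) ?_ ?_).symm⟩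
    · field_simp
    · field_simp
      exact hdet.symm

/-- The string conditions for a family of null vectors on which `A` and `D` act as ladder
operators. -/
theorem QISMI.StringConditions.of_ladder {W : Type*} [AddCommGroup W] [Module ℂ W]
    {ρ : QISMI →ₐ[ℂ] Module.End ℂ W} {F : ℂ → W} {α β : ℂ → ℂ}
    (hF : ∀ u, F u ≠ 0) (hC : ∀ u, ρ (C u) (F u) = 0)
    (hspan : ∀ u w, ρ (C u) w = 0 → ∃ r : ℂ, r • F u = w)
    (hA : ∀ u, ρ (A u) (F u) = α u • F (u - 1)) (hD : ∀ u, ρ (D u) (F u) = β u • F (u + 1))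
    {u₀ : ℂ} {jm : WithBot ℤ} {jp : WithTop ℤ}
    (hα : ∀ m : ℤ, jm < m → (m : WithTop ℤ) < jp →
      (α (u₀ + m) = 0 ↔ jm + 1 = (m : WithBot ℤ)))
    (hβ : ∀ m : ℤ, jm < m → (m : WithTop ℤ) < jp →
      (β (u₀ + m) = 0 ↔ (m : WithTop ℤ) + 1 = jp)) :
    StringConditions ρ u₀ jm jp where
  finrank_ker m _ _ := by
    rw [finrank_eq_one_iff_of_nonzero' (⟨F (u₀ + m), hC _⟩ : LinearMap.ker (ρ (C (u₀ + m))))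
      (fun h => hF (u₀ + m) (congrArg Subtype.val h))]
    rintro ⟨w, hw⟩
    obtain ⟨r, hr⟩ := hspan _ w hw
    exact ⟨r, Subtype.ext hr⟩
  lower m h1 h2 w hw hCw := by
    obtain ⟨r, rfl⟩ := hspan _ w hCw
    have hr : r ≠ 0 := fun h => hw (by rw [h, zero_smul])
    -- A null vector is a nonzero multiple of F(u) and F(u - 1) ≠ 0, so only the ladder factor can
    -- vanish.
    rw [map_smul, hA, ← hα m h1 h2, smul_eq_zero_iff_right hr, smul_eq_zero]
    exact or_iff_left (hF _)
  upper m h1 h2 w hw hCw := by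
    obtain ⟨r, rfl⟩ := hspan _ w hCw
    have hr : r ≠ 0 := fun h => hw (by rw [h, zero_smul])
    rw [map_smul, hD, ← hβ m h1 h2, smul_eq_zero_iff_right hr, smul_eq_zero]
    exact or_iff_left (hF _)

theorem bot_add_one_ne_intCast (m : ℤ) : (⊥ : WithBot ℤ) + 1 ≠ (m : WithBot ℤ) := by
  rw [WithBot.bot_add]; exact WithBot.bot_ne_coe

theorem intCast_add_one_ne_top (m : ℤ) : (m : WithTop ℤ) + 1 ≠ ⊤ := by
  exact_mod_cast WithTop.coe_ne_top

theorem intCast_add_one_eq_one_iff (m : ℤ) : (m : WithTop ℤ) + 1 = 1 ↔ m = 0 := by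
  have : (m : WithTop ℤ) + 1 = ((m + 1 : ℤ) : WithTop ℤ) := rfl
  rw [this, show (1 : WithTop ℤ) = ((1 : ℤ) : WithTop ℤ) from rfl, WithTop.coe_inj]
  omega

theorem intCast_lt_one_iff (m : ℤ) : (m : WithTop ℤ) < 1 ↔ m ≤ 0 := by
  rw [show (1 : WithTop ℤ) = ((1 : ℤ) : WithTop ℤ) from rfl, WithTop.coe_lt_coe]
  omega

/-! ### Laguerre polynomials -/

theorem ascPochhammer_eval_neg_natCast (n k : ℕ) :
    (ascPochhammer ℂ k).eval (-(n : ℂ)) = (-1) ^ k * (n.descFactorial k : ℂ) := by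
  rw [ascPochhammer_eval_neg_eq_descPochhammer, descPochhammer_eval_eq_descFactorial]

/-- The factor (-n)_k = (-1)^k n!/(n-k)! vanishes for k > n and truncates the series. The remaining
terms match through (c)_n = (c)_k (c+k)_{n-k}. -/
theorem laguerre_eq_oneFOne {c : ℂ} (hc : ∀ n : ℕ, c ≠ -(n : ℂ)) (n : ℕ) (x : ℂ) :
    laguerre n (c - 1) x =
      (ascPochhammer ℂ n).eval c / (n.factorial : ℂ) * oneFOne (-(n : ℂ)) c x := by
  rw [oneFOne, tsum_eq_sum (s := Finset.range (n + 1)), laguerre, Finset.mul_sum]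
  · refine Finset.sum_congr rfl fun k hk => ?_
    have hkn : k ≤ n := Nat.lt_succ_iff.1 (Finset.mem_range.1 hk)
    have hf : ((n - k)! : ℂ) * (n.descFactorial k : ℂ) = (n ! : ℂ) := by
      exact_mod_cast Nat.factorial_mul_descFactorial hkn
    have hp : (ascPochhammer ℂ n).eval c =
        (ascPochhammer ℂ k).eval c * (ascPochhammer ℂ (n - k)).eval (c + k) := by
      have := ascPochhammer_mul ℂ k (n - k)
      rw [Nat.add_sub_cancel' hkn] at this
      rw [← this]
      simp
    have h1 := ascPochhammer_eval_ne_zero hc k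
    have h2 : ((n - k)! : ℂ) ≠ 0 := by exact_mod_cast (n - k).factorial_ne_zero
    have h3 : (n ! : ℂ) ≠ 0 := by exact_mod_cast n.factorial_ne_zero
    have h4 : (k ! : ℂ) ≠ 0 := by exact_mod_cast k.factorial_ne_zero
    rw [ascPochhammer_eval_neg_natCast, hp, show c - 1 + k + 1 = c + k by ring]
    field_simp
    linear_combination -((ascPochhammer ℂ (n - k)).eval (c + k) * x ^ k) * hf
  · intro k hk
    have : n < k := by simpa [Nat.lt_succ_iff] using hk
    rw [ascPochhammer_eval_neg_natCast, Nat.descFactorial_of_lt this]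
    simp

/-! ### The representations of types B and D' -/

theorem typeB_C_apply (a c u : ℂ) (f : entireFun) :
    ((typeB a c u 1 0 f : entireFun) : ℂ → ℂ) = -kummerOp (a + u) c f := by
  funext x
  rw [Pi.neg_apply, kummerOp, iteratedDeriv_succ, iteratedDeriv_one]
  change -((x * deriv (deriv (f : ℂ → ℂ)) x + (c • deriv (f : ℂ → ℂ) x -
    x * deriv (f : ℂ → ℂ) x)) - (a + u) • (f : ℂ → ℂ) x) = -_
  simp only [smul_eq_mul]
  ring

theorem typeB_A_apply (a c u : ℂ) (f : entireFun) (x : ℂ) :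
    ((typeB a c u 0 0 f : entireFun) : ℂ → ℂ) x =
      x * deriv (f : ℂ → ℂ) x - x * (f : ℂ → ℂ) x + (c - a - u) * (f : ℂ → ℂ) x :=
  rfl

theorem typeB_D_apply (a c u : ℂ) (f : entireFun) (x : ℂ) :
    ((typeB a c u 1 1 f : entireFun) : ℂ → ℂ) x =
      x * deriv (f : ℂ → ℂ) x + (a + u) * (f : ℂ → ℂ) x :=
  rfl

theorem typeD'_C_apply (u : ℂ) (f : polyGrowthFun) :
    ((typeD' u 1 0 f : polyGrowthFun) : ℂ → ℂ) = -hermiteOp u f := by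
  funext x
  rw [Pi.neg_apply, hermiteOp, iteratedDeriv_succ, iteratedDeriv_one]
  rfl

theorem typeD'_A_apply (u : ℂ) (f : polyGrowthFun) (x : ℂ) :
    ((typeD' u 0 0 f : polyGrowthFun) : ℂ → ℂ) x =
      deriv (f : ℂ → ℂ) x - x * (f : ℂ → ℂ) x :=
  rfl

theorem typeD'_D_apply (u : ℂ) (f : polyGrowthFun) :
    ((typeD' u 1 1 f : polyGrowthFun) : ℂ → ℂ) = deriv (f : ℂ → ℂ) :=
  rfl

/-! ### Ladder operators for Kummer's equation -/

theorem kummerOp_eq_of_hasDerivAt (a c : ℂ) {f f₁ f₂ : ℂ → ℂ}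
    (h₁ : ∀ x, HasDerivAt f (f₁ x) x) (h₂ : ∀ x, HasDerivAt f₁ (f₂ x) x) (x : ℂ) :
    kummerOp a c f x = x * f₂ x + (c - x) * f₁ x - a * f x := by
  have e : deriv f = f₁ := funext fun y => (h₁ y).deriv
  rw [kummerOp, iteratedDeriv_succ, iteratedDeriv_one, e, (h₂ x).deriv]

/-- `x∂ - x + c - a` maps solutions of parameter `a` to solutions of parameter `a - 1`. -/
theorem kummerOp_lower {a c : ℂ} {f : ℂ → ℂ} (hf : Differentiable ℂ f)
    (h : kummerOp a c f = 0) :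
    kummerOp (a - 1) c (fun x => x * deriv f x - x * f x + (c - a) * f x) = 0 := by
  have d0 := fun x => (hf x).hasDerivAt
  have d1 : ∀ x, HasDerivAt (deriv f) (iteratedDeriv 2 f x) x := fun x => by
    simpa using hasDerivAt_iteratedDeriv_entire hf 1 x
  have d2 := hasDerivAt_iteratedDeriv_entire hf 2
  funext x
  refine (kummerOp_eq_of_hasDerivAt (a - 1) c
    (fun x => (((hasDerivAt_id x).mul (d1 x)).sub ((hasDerivAt_id x).mul (d0 x))).add
      ((d0 x).const_mul (c - a)))
    (fun x => ((((d1 x).const_mul 1).add ((hasDerivAt_id x).mul (d2 x))).sub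
      (((d0 x).const_mul 1).add ((hasDerivAt_id x).mul (d1 x)))).add
        ((d1 x).const_mul (c - a))) x).trans ?_
  have h0 := congrFun h x
  have h1 := congrFun (iteratedDeriv_kummerOp a c hf 1) x
  rw [h] at h1
  simp [kummerOp] at h0 h1
  simp only [id, Nat.reduceAdd, Pi.zero_apply, Pi.add_apply, Pi.sub_apply, Pi.mul_apply]
  -- With K_a the Kummer operator, this is K_{a-1}(x∂ - x + c - a) = (x∂ - x + c - a + 1)K_a.
  linear_combination -x * h1 + (1 - a + c - x) * h0

/-- `x∂ + a` maps solutions of parameter `a` to solutions of parameter `a + 1`. -/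
theorem kummerOp_raise {a c : ℂ} {f : ℂ → ℂ} (hf : Differentiable ℂ f)
    (h : kummerOp a c f = 0) :
    kummerOp (a + 1) c (fun x => x * deriv f x + a * f x) = 0 := by
  have d0 := fun x => (hf x).hasDerivAt
  have d1 : ∀ x, HasDerivAt (deriv f) (iteratedDeriv 2 f x) x := fun x => by
    simpa using hasDerivAt_iteratedDeriv_entire hf 1 x
  have d2 := hasDerivAt_iteratedDeriv_entire hf 2
  funext x
  refine (kummerOp_eq_of_hasDerivAt (a + 1) c
    (fun x => ((hasDerivAt_id x).mul (d1 x)).add ((d0 x).const_mul a))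
    (fun x => (((d1 x).const_mul 1).add ((hasDerivAt_id x).mul (d2 x))).add
      ((d1 x).const_mul a)) x).trans ?_
  have h0 := congrFun h x
  have h1 := congrFun (iteratedDeriv_kummerOp a c hf 1) x
  rw [h] at h1
  simp [kummerOp] at h0 h1
  simp only [id, Nat.reduceAdd, Pi.zero_apply, Pi.add_apply, Pi.mul_apply]
  -- The corresponding relation is K_{a+1}(x∂ + a) = (x∂ + a + 1)K_a.
  linear_combination -x * h1 + (1 + a) * h0

/-- The left side is an entire solution with parameter a - 1, hence a multiple of ₁F₁(a - 1; c; x).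
The factor is its value at 0, where the terms containing x vanish. -/
theorem oneFOne_lower {c : ℂ} (hc : ∀ n : ℕ, c ≠ -(n : ℂ)) (a : ℂ) :
    (fun x => x * deriv (oneFOne a c) x - x * oneFOne a c x + (c - a) * oneFOne a c x) =
      (c - a) • oneFOne (a - 1) c := by
  have hf := differentiable_oneFOne hc a
  have := eq_smul_oneFOne hc (((differentiable_id.mul (differentiable_deriv_of_entire hf)).sub
    (differentiable_id.mul hf)).add (hf.const_mul (c - a)))
    (kummerOp_lower hf (kummerOp_oneFOne hc a))
  refine this.trans ?_
  simp [oneFOne_zero hc]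

theorem oneFOne_raise {c : ℂ} (hc : ∀ n : ℕ, c ≠ -(n : ℂ)) (a : ℂ) :
    (fun x => x * deriv (oneFOne a c) x + a * oneFOne a c x) = a • oneFOne (a + 1) c := by
  have hf := differentiable_oneFOne hc a
  have := eq_smul_oneFOne hc ((differentiable_id.mul (differentiable_deriv_of_entire hf)).add
    (hf.const_mul a)) (kummerOp_raise hf (kummerOp_oneFOne hc a))
  refine this.trans ?_
  simp [oneFOne_zero hc]

theorem opX_entireFun_injective : Function.Injective (opX entireFun) := by
  refine (injective_iff_map_eq_zero _).2 fun f hf => ?_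
  have h : ∀ x : ℂ, x * (f : ℂ → ℂ) x = 0 := fun x => congrFun (congrArg Subtype.val hf) x
  have hd : Differentiable ℂ (f : ℂ → ℂ) := f.2
  have h' : ∀ x : ℂ, x ≠ 0 → (f : ℂ → ℂ) x = 0 := fun x hx =>
    (mul_eq_zero.1 (h x)).resolve_left hx
  have he : (f : ℂ → ℂ) = 0 := hd.continuous.ext_on (dense_compl_singleton (0 : ℂ))
    continuous_zero fun x hx => h' x hx
  exact Subtype.ext he

theorem mainTheorem7 :
    -- Type B
    (∀ a c : ℂ, (∀ n : ℕ, c ≠ -(n : ℂ)) →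
      ∃ (ρ : QISMI →ₐ[ℂ] Module.End ℂ entireFun) (F : ℂ → entireFun),
        -- a representation by the given operators, with `B₀` injective
        (∀ u : ℂ, (QISMI.T u).map ρ = typeB a c u) ∧
        (∀ u : ℂ, Function.Injective (ρ (QISMI.B u))) ∧
        -- with scalar quantum determinant `αδu² + Q₁u + Q₀`
        (∀ u : ℂ, ρ (QISMI.qdet u) =
          (-u ^ 2 + (c - 2 * a) * u + (a * (c - a) - c / 2 + 1 / 4)) • 1) ∧
        -- the vectors `F(u)`
        (∀ u x : ℂ, (F u : ℂ → ℂ) x = oneFOne (a + u) c x) ∧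
        (∀ u : ℂ, F u ≠ 0 ∧ ρ (QISMI.C u) (F u) = 0) ∧
        (∀ u : ℂ, ρ (QISMI.A u) (F u) = (c - a - u) • F (u - 1)) ∧
        (∀ u : ℂ, ρ (QISMI.D u) (F u) = (a + u) • F (u + 1)) ∧
        -- the sets `𝒟 = u₀ + ℤ` and `𝒟 = {-a, -a - 1, -a - 2, …}`
        (∀ u₀ : ℂ, (∀ m : ℤ, u₀ ≠ -a + m) → (∀ m : ℤ, u₀ ≠ c - a + m) →
          QISMI.StringConditions ρ u₀ ⊥ ⊤) ∧
        QISMI.StringConditions ρ (-a) ⊥ 1 ∧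
        -- Laguerre polynomials
        (∀ (n : ℕ) (x : ℂ), laguerre n (c - 1) x =
          (ascPochhammer ℂ n).eval c / (n.factorial : ℂ) * (F (-a - n) : ℂ → ℂ) x)) ∧
    -- Type D'
    (∃ (ρ : QISMI →ₐ[ℂ] Module.End ℂ polyGrowthFun) (F : ℂ → polyGrowthFun),
        -- a representation by the given operators, with `B₀` injective
        (∀ u : ℂ, (QISMI.T u).map ρ = typeD' u) ∧
        (∀ u : ℂ, Function.Injective (ρ (QISMI.B u))) ∧
        -- with scalar quantum determinant
        (∀ u : ℂ, ρ (QISMI.qdet u) = (u - 1 / 2) • 1) ∧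
        -- the vectors `F(u)`
        (∀ u x : ℂ, (F u : ℂ → ℂ) x = Complex.exp (x ^ 2 / 4) * parabolicCylinderD (-u) x) ∧
        (∀ u : ℂ, F u ≠ 0 ∧ ρ (QISMI.C u) (F u) = 0) ∧
        (∀ u : ℂ, ρ (QISMI.A u) (F u) = -F (u - 1)) ∧
        (∀ u : ℂ, ρ (QISMI.D u) (F u) = (-u) • F (u + 1)) ∧
        -- their normalization `F(u)(x) = x^{-u} + O(x^{-u-2})` as `x → ∞`
        (∀ u : ℂ, (fun x : ℝ => (F u : ℂ → ℂ) x - (x : ℂ) ^ (-u)) =O[Filter.atTop]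
          (fun x : ℝ => (x : ℂ) ^ (-u - 2))) ∧
        -- the sets `𝒟 = u₀ + ℤ` and `𝒟 = {0, -1, -2, …}`
        (∀ u₀ : ℂ, (∀ m : ℤ, u₀ ≠ m) → QISMI.StringConditions ρ u₀ ⊥ ⊤) ∧
        QISMI.StringConditions ρ 0 ⊥ 1 ∧
        -- Hermite polynomials `He_n(x) = 2^{-n/2} H_n(2^{-1/2} x)`
        (∀ (n : ℕ) (x : ℂ),
          (F (-(n : ℂ)) : ℂ → ℂ) x = Polynomial.aeval x (Polynomial.hermite n))) := by
  constructor
  · intro a c hc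
    obtain ⟨ρ, hρ⟩ := QISMI.exists_algHom (t := typeB a c)
      (QISMI.entryRTT_kummer (E := Module.End ℂ entireFun) (opD_mul_opX entireFun) a c)
    have hρA : ∀ u, ρ (QISMI.A u) = typeB a c u 0 0 := fun u => congrFun₂ (hρ u) 0 0
    have hρB : ∀ u, ρ (QISMI.B u) = typeB a c u 0 1 := fun u => congrFun₂ (hρ u) 0 1
    have hρC : ∀ u, ρ (QISMI.C u) = typeB a c u 1 0 := fun u => congrFun₂ (hρ u) 1 0
    have hρD : ∀ u, ρ (QISMI.D u) = typeB a c u 1 1 := fun u => congrFun₂ (hρ u) 1 1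
    let F : ℂ → entireFun := fun u => ⟨oneFOne (a + u) c, differentiable_oneFOne hc _⟩
    have hF : ∀ u, F u ≠ 0 := fun u h => by
      have h0 : oneFOne (a + u) c 0 = 0 := congrFun (congrArg Subtype.val h) 0
      rw [oneFOne_zero hc] at h0
      exact one_ne_zero h0
    have hC : ∀ u, ρ (QISMI.C u) (F u) = 0 := fun u => by
      rw [hρC]
      refine Subtype.ext ((typeB_C_apply a c u (F u)).trans ?_)
      change -kummerOp (a + u) c (oneFOne (a + u) c) = 0
      rw [kummerOp_oneFOne hc, neg_zero]
    have hspan : ∀ u w, ρ (QISMI.C u) w = 0 → ∃ r : ℂ, r • F u = w := fun u w hw => by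
      rw [hρC] at hw
      have h : -kummerOp (a + u) c (w : ℂ → ℂ) = 0 :=
        (typeB_C_apply a c u w).symm.trans (congrArg Subtype.val hw)
      exact ⟨(w : ℂ → ℂ) 0, Subtype.ext (eq_smul_oneFOne hc w.2 (neg_eq_zero.1 h)).symm⟩
    have hA : ∀ u, ρ (QISMI.A u) (F u) = (c - a - u) • F (u - 1) := fun u => by
      rw [hρA]
      refine Subtype.ext (funext fun x => (typeB_A_apply a c u (F u) x).trans ?_)
      have h := congrFun (oneFOne_lower hc (a + u)) x
      rw [← sub_sub, add_sub_assoc] at h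
      exact h
    have hD : ∀ u, ρ (QISMI.D u) (F u) = (a + u) • F (u + 1) := fun u => by
      rw [hρD]
      refine Subtype.ext (funext fun x => (typeB_D_apply a c u (F u) x).trans ?_)
      have h := congrFun (oneFOne_raise hc (a + u)) x
      rw [add_assoc] at h
      exact h
    refine ⟨ρ, F, hρ, fun u => ?_, fun u => ?_, fun u x => rfl, fun u => ⟨hF u, hC u⟩, hA, hD,
      fun u₀ h1 h2 => ?_, ?_, fun n x => ?_⟩
    · rw [hρB]
      exact fun f g h => opX_entireFun_injective (neg_injective h)
    · rw [QISMI.qdet, map_sub, map_mul, map_mul, hρA, hρB, hρC, hρD]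
      exact QISMI.qdet_kummer (E := Module.End ℂ entireFun) (opD_mul_opX entireFun) a c u
    · refine QISMI.StringConditions.of_ladder hF hC hspan hA hD (fun m _ _ => ?_) fun m _ _ => ?_
      · refine iff_of_false (fun h => h2 (-m) ?_) (bot_add_one_ne_intCast m)
        push_cast
        linear_combination -h
      · refine iff_of_false (fun h => h1 (-m) ?_) (intCast_add_one_ne_top m)
        push_cast
        linear_combination h
    · refine QISMI.StringConditions.of_ladder hF hC hspan hA hD (fun m _ hm => ?_) fun m _ _ => ?_
      -- At u = -a + m the factor of A is c - m with m ≤ 0; its vanishing would make c a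
      -- non-positive integer.
      · refine iff_of_false (fun h => hc (-m).toNat ?_) (bot_add_one_ne_intCast m)
        rw [intCast_lt_one_iff] at hm
        have : (((-m).toNat : ℤ) : ℂ) = ((-m : ℤ) : ℂ) := by rw [Int.toNat_of_nonneg (by omega)]
        push_cast at this
        linear_combination h + this
      -- The factor of D at u = -a + m is m, which vanishes only at the upper end m = 0.
      · rw [intCast_add_one_eq_one_iff, add_neg_cancel_left, Int.cast_eq_zero]
    · change _ = _ * oneFOne (a + (-a - n)) c x
      rw [show a + (-a - (n : ℂ)) = -n by ring]
      exact laguerre_eq_oneFOne hc n x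
  · obtain ⟨ρ, hρ⟩ := QISMI.exists_algHom (t := typeD')
      (QISMI.entryRTT_hermite (E := Module.End ℂ polyGrowthFun) (opD_mul_opX polyGrowthFun))
    have hρA : ∀ u, ρ (QISMI.A u) = typeD' u 0 0 := fun u => congrFun₂ (hρ u) 0 0
    have hρB : ∀ u, ρ (QISMI.B u) = typeD' u 0 1 := fun u => congrFun₂ (hρ u) 0 1
    have hρC : ∀ u, ρ (QISMI.C u) = typeD' u 1 0 := fun u => congrFun₂ (hρ u) 1 0
    have hρD : ∀ u, ρ (QISMI.D u) = typeD' u 1 1 := fun u => congrFun₂ (hρ u) 1 1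
    let F : ℂ → polyGrowthFun := fun u => ⟨weber u, weber_mem_polyGrowthFun u⟩
    have hF : ∀ u, F u ≠ 0 := fun u h => weber_ne_zero u (congrArg Subtype.val h)
    have hC : ∀ u, ρ (QISMI.C u) (F u) = 0 := fun u => by
      rw [hρC]
      refine Subtype.ext ((typeD'_C_apply u (F u)).trans ?_)
      change -hermiteOp u (weber u) = 0
      rw [hermiteOp_weber, neg_zero]
    have hspan : ∀ u w, ρ (QISMI.C u) w = 0 → ∃ r : ℂ, r • F u = w := fun u w hw => by
      rw [hρC] at hw
      have h : -hermiteOp u (w : ℂ → ℂ) = 0 :=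
        (typeD'_C_apply u w).symm.trans (congrArg Subtype.val hw)
      obtain ⟨r, hr⟩ := eq_smul_weber w.2 (neg_eq_zero.1 h)
      exact ⟨r, Subtype.ext hr⟩
    have hA : ∀ u, ρ (QISMI.A u) (F u) = (-1 : ℂ) • F (u - 1) := fun u => by
      rw [hρA]
      exact Subtype.ext (funext fun x =>
        (typeD'_A_apply u (F u) x).trans (congrFun (deriv_weber_sub u) x))
    have hD : ∀ u, ρ (QISMI.D u) (F u) = (-u) • F (u + 1) := fun u => by
      rw [hρD]
      exact Subtype.ext ((typeD'_D_apply u (F u)).trans (deriv_weber u))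
    refine ⟨ρ, F, hρ, fun u => ?_, fun u => ?_, fun u x => (exp_mul_parabolicCylinderD u x).symm,
      fun u => ⟨hF u, hC u⟩, fun u => (hA u).trans (neg_one_smul ℂ (F (u - 1))), hD, weberAsymptotic,
      fun u₀ h1 => ?_, ?_, weber_neg_nat⟩
    · rw [hρB]
      exact neg_injective
    · rw [QISMI.qdet, map_sub, map_mul, map_mul, hρA, hρB, hρC, hρD]
      exact QISMI.qdet_hermite (E := Module.End ℂ polyGrowthFun) u
    · refine QISMI.StringConditions.of_ladder hF hC hspan hA hD
        (fun m _ _ => iff_of_false (neg_ne_zero.2 one_ne_zero) (bot_add_one_ne_intCast m))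
        fun m _ _ => ?_
      refine iff_of_false (fun h => h1 (-m) ?_) (intCast_add_one_ne_top m)
      push_cast
      linear_combination -h
    · refine QISMI.StringConditions.of_ladder hF hC hspan hA hD
        (fun m _ _ => iff_of_false (neg_ne_zero.2 one_ne_zero) (bot_add_one_ne_intCast m))
        fun m _ _ => ?_
      rw [intCast_add_one_eq_one_iff, zero_add, neg_eq_zero, Int.cast_eq_zero]
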